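/- Let $U=\begin{pmatrix}a&b\\c&d\end{pmatrix}$ be a unitary complex matrix with $abcd\neq0$, and let $\varphi={}^t[\alpha,\beta]\in\mathbb C^2$ with $|\alpha|^2+|\beta|^2=1$. Put $$P_A=\begin{pmatrix}a&b\\0&0\end{pmatrix},\quad Q_A=\begin{pmatrix}0&0\\c&d\end{pmatrix},\qquad P_G=\begin{pmatrix}a&0\\c&0\end{pmatrix},\quad Q_G=\begin{pmatrix}0&b\\0&d\end{pmatrix}.$$ For $j\in\{A,G\}$ define amplitudes $\Psi_{j,k}(n)\in\mathbb C^2$ ($k\in\mathbb Z$, $n\ge0$) by $\Psi_{j,0}(0)=\varphi$, $\Psi_{j,k}(0)=0$ for $k\ne0$, and $$\Psi_{j,k}(n+1)=P_j\Psi_{j,k+1}(n)+Q_j\Psi_{j,k-1}(n).$$ For each $n$ the numbers $\|\Psi_{j,k}(n)\|^2$ ($k\in\mathbb Z$, Euclidean norm) sum to $1$; let $X^{\varphi}_{j,n}$ (the $j$-type quantum walk at time $n$) be a $\mathbb Z$-valued random variable with $P(X^{\varphi}_{j,n}=k)=\|\Psi_{j,k}(n)\|^2$. Let $$\Theta_A=a\alpha\overline{b\beta}+\overline{a\alpha}\,b\beta,\qquad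 \Theta_G=a\beta\overline{c\alpha}+\overline{a\beta}\,c\alpha .$$ Then, for each $j\in\{A,G\}$, as $n\to\infty$, $X^{\varphi}_{j,n}/n$ converges in distribution to a random variable $Z^{\varphi}_j$ whose law has the (nonnegative) density $$f_j(x)=\frac{\sqrt{1-|a|^2}}{\pi(1-x^2)\sqrt{|a|^2-x^2}}\left\{1-\left(|\alpha|^2-|\beta|^2+\frac{\Theta_j}{|a|^2}\right)x\right\}\quad\text{for }x\in(-|a|,|a|),$$ and $f_j(x)=0$ for all other real $x$. Moreover, $Z^{\varphi}_j$ has finite first and second moments, with $$E(Z^{\varphi}_j)=-\left(|\alpha|^2-|\beta|^2+\frac{\Theta_j}{|a|^2}\right)\left(1-\sqrt{1-|a|^2}\right),\qquad E\big((Z^{\varphi}_j)^2\big)=1-\sqrt{1-|a|^2}.$$ -/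

import Mathlib

open MeasureTheory ProbabilityTheory Filter Topology
open scoped Matrix ComplexConjugate ENNReal

noncomputable section

namespace QuantumWalk

/-- The two types of one-dimensional quantum walks: Ambainis type and Gudder type. -/
inductive WalkType
  | A
  | G

/-- The part of the coin matrix `U = [a, b; c, d]` that moves the particle to the left:
`[a, b; 0, 0]` for the A-type and `[a, 0; c, 0]` for the G-type. -/
def leftMatrix (j : WalkType) (U : Matrix (Fin 2) (Fin 2) ℂ) : Matrix (Fin 2) (Fin 2) ℂ :=
  match j with
  | .A => !![U 0 0, U 0 1; 0, 0]
  | .G => !![U 0 0, 0; U 1 0, 0]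

/-- The part of the coin matrix `U = [a, b; c, d]` that moves the particle to the right:
`[0, 0; c, d]` for the A-type and `[0, b; 0, d]` for the G-type. -/
def rightMatrix (j : WalkType) (U : Matrix (Fin 2) (Fin 2) ℂ) : Matrix (Fin 2) (Fin 2) ℂ :=
  match j with
  | .A => !![0, 0; U 1 0, U 1 1]
  | .G => !![0, U 0 1; 0, U 1 1]

/-- The amplitude at time `n` and location `k` of the walk started at the origin in the state `φ`;
index `0` is the left and index `1` the right chirality. -/
def amplitude (j : WalkType) (U : Matrix (Fin 2) (Fin 2) ℂ) (φ : Fin 2 → ℂ) :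
    ℕ → ℤ → Fin 2 → ℂ
  | 0, k => if k = 0 then φ else 0
  | n + 1, k => leftMatrix j U *ᵥ amplitude j U φ n (k + 1) +
      rightMatrix j U *ᵥ amplitude j U φ n (k - 1)

/-- The probability that the particle is at location `k` at time `n`: the squared modulus of the
amplitude. -/
def locationProb (j : WalkType) (U : Matrix (Fin 2) (Fin 2) ℂ) (φ : Fin 2 → ℂ) (n : ℕ) (k : ℤ) :
    ℝ :=
  ‖amplitude j U φ n k 0‖ ^ 2 + ‖amplitude j U φ n k 1‖ ^ 2

/-- Initial qubit states: unit vectors of `ℂ²`. -/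
abbrev QubitState : Type := {φ : Fin 2 → ℂ // ‖φ 0‖ ^ 2 + ‖φ 1‖ ^ 2 = 1}

theorem norm_sq_mulVec (U : Matrix.unitaryGroup (Fin 2) ℂ) (v : Fin 2 → ℂ) :
    ‖((U : Matrix (Fin 2) (Fin 2) ℂ) *ᵥ v) 0‖ ^ 2 + ‖((U : Matrix (Fin 2) (Fin 2) ℂ) *ᵥ v) 1‖ ^ 2
      = ‖v 0‖ ^ 2 + ‖v 1‖ ^ 2 := by
  have key : ∀ w : Fin 2 → ℂ, ((‖w 0‖ ^ 2 + ‖w 1‖ ^ 2 : ℝ) : ℂ) = star w ⬝ᵥ w := by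
    intro w
    simp [dotProduct, Fin.sum_univ_two, Complex.conj_mul']
  have hU : star (U : Matrix (Fin 2) (Fin 2) ℂ) * (U : Matrix (Fin 2) (Fin 2) ℂ) = 1 :=
    Matrix.UnitaryGroup.star_mul_self U
  rw [← Complex.ofReal_inj, key, key, Matrix.star_mulVec, ← Matrix.dotProduct_mulVec,
    Matrix.mulVec_mulVec]
  rw [Matrix.star_eq_conjTranspose] at hU
  rw [hU, Matrix.one_mulVec]

/-- The amplitudes always define a probability distribution for the location. -/
theorem hasSum_locationProb (j : WalkType) (U : Matrix.unitaryGroup (Fin 2) ℂ) (φ : QubitState)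
    (n : ℕ) : HasSum (locationProb j U φ.1 n) 1 := by
  have shift : ∀ f g : ℤ → ℝ, (∀ k, 0 ≤ f k) → (∀ k, 0 ≤ g k) →
      HasSum (fun k => f k + g k) 1 → HasSum (fun k => f (k + 1) + g (k - 1)) 1 := by
    intro f g hf hg h
    have sf : Summable f :=
      Summable.of_nonneg_of_le hf (fun k => le_add_of_nonneg_right (hg k)) h.summable
    have sg : Summable g :=
      Summable.of_nonneg_of_le hg (fun k => le_add_of_nonneg_left (hf k)) h.summable
    have e := (sf.hasSum.add sg.hasSum).unique h
    rw [← e]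
    exact ((Equiv.addRight (1 : ℤ)).hasSum_iff.mpr sf.hasSum).add
      ((Equiv.subRight (1 : ℤ)).hasSum_iff.mpr sg.hasSum)
  induction n with
  | zero =>
    have h0 : locationProb j U φ.1 0 0 = 1 := by
      simpa [locationProb, amplitude] using φ.2
    have h := hasSum_single (f := locationProb j U φ.1 0) 0 fun k hk => by
      simp [locationProb, amplitude, hk]
    rw [h0] at h
    exact h
  | succ n ih =>
    cases j with
    | A =>
      have h := shift
        (fun k => ‖((U : Matrix (Fin 2) (Fin 2) ℂ) *ᵥ amplitude .A U φ.1 n k) 0‖ ^ 2)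
        (fun k => ‖((U : Matrix (Fin 2) (Fin 2) ℂ) *ᵥ amplitude .A U φ.1 n k) 1‖ ^ 2)
        (fun k => by positivity) (fun k => by positivity)
        (by simp only [norm_sq_mulVec]; exact ih)
      convert h using 2 with k
      simp [locationProb, amplitude, leftMatrix, rightMatrix, Matrix.mulVec, dotProduct,
        Fin.sum_univ_two]
    | G =>
      have h := shift
        (fun k => ‖amplitude .G U φ.1 n k 0‖ ^ 2) (fun k => ‖amplitude .G U φ.1 n k 1‖ ^ 2)
        (fun k => by positivity) (fun k => by positivity) ih
      convert h using 2 with k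
      have e := norm_sq_mulVec U
        ![amplitude .G U φ.1 n (k + 1) 0, amplitude .G U φ.1 n (k - 1) 1]
      simpa [locationProb, amplitude, leftMatrix, rightMatrix, Matrix.mulVec, dotProduct,
        Fin.sum_univ_two] using e

/-- The distribution on `ℤ` of the walk at time `n`. -/
def walkPMF (j : WalkType) (U : Matrix.unitaryGroup (Fin 2) ℂ) (φ : QubitState) (n : ℕ) : PMF ℤ :=
  ⟨fun k => ENNReal.ofReal (locationProb j U φ.1 n k), by
    have h := hasSum_locationProb j U φ n
    have hn : ∀ k, 0 ≤ locationProb j U φ.1 n k := fun k => by unfold locationProb; positivity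
    have e := ENNReal.ofReal_tsum_of_nonneg hn h.summable
    rw [h.tsum_eq, ENNReal.ofReal_one] at e
    rw [e]
    exact ENNReal.summable.hasSum⟩

/-- `Θ_A = aα·conj(bβ) + conj(aα)·bβ` and `Θ_G = aβ·conj(cα) + conj(aβ)·cα`. Both numbers are
real; the real part only turns them into elements of `ℝ`. -/
def Theta (j : WalkType) (U : Matrix (Fin 2) (Fin 2) ℂ) (φ : Fin 2 → ℂ) : ℝ :=
  match j with
  | .A => (U 0 0 * φ 0 * conj (U 0 1 * φ 1) + conj (U 0 0 * φ 0) * (U 0 1 * φ 1)).re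
  | .G => (U 0 0 * φ 1 * conj (U 1 0 * φ 0) + conj (U 0 0 * φ 1) * (U 1 0 * φ 0)).re

/-- The coefficient `|α|² - |β|² + Θ_j / |a|²`. -/
def asymmetry (j : WalkType) (U : Matrix (Fin 2) (Fin 2) ℂ) (φ : Fin 2 → ℂ) : ℝ :=
  ‖φ 0‖ ^ 2 - ‖φ 1‖ ^ 2 + Theta j U φ / ‖U 0 0‖ ^ 2

open Classical in
/-- The limit density; it vanishes outside `(-|a|, |a|)`. -/
def limitDensity (j : WalkType) (U : Matrix (Fin 2) (Fin 2) ℂ) (φ : Fin 2 → ℂ) (x : ℝ) : ℝ :=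
  if x ∈ Set.Ioo (-‖U 0 0‖) ‖U 0 0‖ then
    √(1 - ‖U 0 0‖ ^ 2) / (Real.pi * (1 - x ^ 2) * √(‖U 0 0‖ ^ 2 - x ^ 2)) *
      (1 - asymmetry j U φ * x)
  else 0

end QuantumWalk

end

open MeasureTheory ProbabilityTheory Filter Topology
open scoped Matrix ComplexConjugate ENNReal

noncomputable section

namespace QuantumWalk

/-! ### The group velocity and its inverse -/

/-! In Fourier space one step of the walk multiplies by a 2×2 matrix `symbol`, and after removing
phases from the coin this matrix has determinant 1 and trace `2 r cos ξ`, where `r = |a|`. It is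
thus a rotation by the quasi-energy `θ(ξ) = arccos (r cos ξ)`, and its `n`-th power sends `φ` to
`cos(nθ) φ + sin(nθ) W(ξ)`, with `W(ξ)` (`rotated`) a unit vector and `⟨φ, W⟩ = i e(ξ)`, `e` real
(`energyMean`).

By Parseval (`sum_locationProb_mul_exp`), the characteristic function of `Xₙ / n` at `t` is the mean
over a period of the inner product of the states at wave numbers `ξ` and `ξ + t/n`. The addition
formulas leave only the phase difference `n(θ(ξ + t/n) - θ(ξ))`, which tends to `t v(ξ)` with `v =
θ'` the group velocity. The integrand tends to `cos(tv) + i e sin(tv)` (`tendsto_charIntegrand`),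
and dominated convergence applies.

The reflection `ξ ↦ π - ξ` fixes `v` and cancels the part of `e` other than `-κ v`, with `κ` the
asymmetry (`integral_limit_charIntegrand`). What remains is the characteristic function of the image
under `v` of the density `(1 - κ v)/π` on `(-π/2, π/2)`. There `v` is injective, and substituting `x
= v(ξ)` gives the stated density. Lévy's continuity theorem concludes. The moments follow from the
oddness of `v` and the integral of `v²`. -/

/-- The derivative of the dispersion relation `ξ ↦ arccos (r cos ξ)`. -/
def groupVelocity (r ξ : ℝ) : ℝ := r * Real.sin ξ / √(1 - r ^ 2 * Real.cos ξ ^ 2)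

/-- The inverse of the group velocity on `(-π/2, π/2)`. -/
def groupVelocityInv (r x : ℝ) : ℝ := Real.arcsin (√(1 - r ^ 2) / r * (x / √(1 - x ^ 2)))

/-- The derivative of `groupVelocityInv`. -/
def arcWeight (r x : ℝ) : ℝ := √(1 - r ^ 2) / ((1 - x ^ 2) * √(r ^ 2 - x ^ 2))

section

variable {r : ℝ}

lemma one_sub_sq_mul_cos_sq_pos (hr : 0 < r) (hr1 : r < 1) (ξ : ℝ) :
    0 < 1 - r ^ 2 * Real.cos ξ ^ 2 := by
  nlinarith [Real.cos_sq_le_one ξ, sq_nonneg r]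

lemma sq_lt_sq_of_mem_Ioo {x : ℝ} (hx : x ∈ Set.Ioo (-r) r) : x ^ 2 < r ^ 2 :=
  sq_lt_sq' hx.1 hx.2

lemma continuous_groupVelocity (hr : 0 < r) (hr1 : r < 1) : Continuous (groupVelocity r) := by
  unfold groupVelocity
  refine Continuous.div (by fun_prop) (by fun_prop) fun ξ => ?_
  exact (Real.sqrt_pos.2 (one_sub_sq_mul_cos_sq_pos hr hr1 ξ)).ne'

lemma groupVelocity_neg (r ξ : ℝ) : groupVelocity r (-ξ) = -groupVelocity r ξ := by
  simp [groupVelocity, neg_div]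

/-- This symmetry reduces an integral over a full period to the half period on which the velocity is
injective. -/
lemma groupVelocity_pi_sub (r ξ : ℝ) : groupVelocity r (Real.pi - ξ) = groupVelocity r ξ := by
  simp [groupVelocity]

lemma groupVelocity_mem_Ioo (hr : 0 < r) (hr1 : r < 1) {ξ : ℝ}
    (hξ : ξ ∈ Set.Ioo (-(Real.pi / 2)) (Real.pi / 2)) : groupVelocity r ξ ∈ Set.Ioo (-r) r := by
  have hc : 0 < Real.cos ξ := Real.cos_pos_of_mem_Ioo hξ
  have hp := one_sub_sq_mul_cos_sq_pos hr hr1 ξ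
  have hlt : |Real.sin ξ| < √(1 - r ^ 2 * Real.cos ξ ^ 2) := by
    refine Real.lt_sqrt_of_sq_lt ?_
    rw [sq_abs, Real.sin_sq]
    have : r ^ 2 < 1 := by nlinarith
    nlinarith [pow_pos hc 2]
  rw [Set.mem_Ioo, ← abs_lt, groupVelocity, abs_div, abs_mul, abs_of_pos hr,
    abs_of_pos (Real.sqrt_pos.2 hp), div_lt_iff₀ (Real.sqrt_pos.2 hp)]
  gcongr

/-- Solving `x = v(ξ)` for `sin ξ` gives the quantity squared here, so the right side is `cos² ξ` in
terms of `x`. The range, the inverse property and the derivative all rest on it. -/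
lemma one_sub_sq_groupVelocityArg (hr : 0 < r) (hr1 : r < 1) {x : ℝ} (hx : x ∈ Set.Ioo (-r) r) :
    1 - (√(1 - r ^ 2) / r * (x / √(1 - x ^ 2))) ^ 2 = (r ^ 2 - x ^ 2) / (r ^ 2 * (1 - x ^ 2)) := by
  have h1 := sq_lt_sq_of_mem_Ioo hx
  have h2 : r ^ 2 < 1 := by nlinarith
  have h3 : 0 < 1 - x ^ 2 := by linarith
  rw [mul_pow, div_pow, div_pow, Real.sq_sqrt (by linarith), Real.sq_sqrt h3.le]
  field_simp
  ring

lemma groupVelocityArg_mem_Ioo (hr : 0 < r) (hr1 : r < 1) {x : ℝ} (hx : x ∈ Set.Ioo (-r) r) :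
    √(1 - r ^ 2) / r * (x / √(1 - x ^ 2)) ∈ Set.Ioo (-1 : ℝ) 1 := by
  have h1 := sq_lt_sq_of_mem_Ioo hx
  have h2 : r ^ 2 < 1 := by nlinarith
  have h3 : 0 < 1 - x ^ 2 := by linarith
  have h := one_sub_sq_groupVelocityArg hr hr1 hx
  have hpos : 0 < (r ^ 2 - x ^ 2) / (r ^ 2 * (1 - x ^ 2)) :=
    div_pos (by linarith) (by positivity)
  rw [Set.mem_Ioo, ← abs_lt, ← sq_lt_one_iff_abs_lt_one]
  linarith

lemma groupVelocityInv_mem_Ioo (hr : 0 < r) (hr1 : r < 1) {x : ℝ} (hx : x ∈ Set.Ioo (-r) r) :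
    groupVelocityInv r x ∈ Set.Ioo (-(Real.pi / 2)) (Real.pi / 2) := by
  have h := groupVelocityArg_mem_Ioo hr hr1 hx
  exact ⟨Real.neg_pi_div_two_lt_arcsin.2 h.1, Real.arcsin_lt_pi_div_two.2 h.2⟩

lemma groupVelocity_groupVelocityInv (hr : 0 < r) (hr1 : r < 1) {x : ℝ}
    (hx : x ∈ Set.Ioo (-r) r) : groupVelocity r (groupVelocityInv r x) = x := by
  have h1 := sq_lt_sq_of_mem_Ioo hx
  have h2 : r ^ 2 < 1 := by nlinarith
  have h3 : 0 < 1 - x ^ 2 := by linarith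
  have h4 : 0 < 1 - r ^ 2 := by linarith
  have h := groupVelocityArg_mem_Ioo hr hr1 hx
  have hsin := Real.sin_arcsin h.1.le h.2.le
  have hcos : 1 - r ^ 2 * Real.cos (groupVelocityInv r x) ^ 2 = (1 - r ^ 2) / (1 - x ^ 2) := by
    rw [Real.cos_sq', groupVelocityInv, hsin, one_sub_sq_groupVelocityArg hr hr1 hx]
    field_simp
    ring
  rw [groupVelocity, hcos, groupVelocityInv, hsin, Real.sqrt_div h4.le]
  have := Real.sqrt_pos.2 h3
  have := Real.sqrt_pos.2 h4
  field_simp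

lemma groupVelocityInv_groupVelocity (hr : 0 < r) (hr1 : r < 1) {ξ : ℝ}
    (hξ : ξ ∈ Set.Ioo (-(Real.pi / 2)) (Real.pi / 2)) :
    groupVelocityInv r (groupVelocity r ξ) = ξ := by
  have hp := one_sub_sq_mul_cos_sq_pos hr hr1 ξ
  have h4 : 0 < 1 - r ^ 2 := by nlinarith
  have h5 : 1 - groupVelocity r ξ ^ 2 = (1 - r ^ 2) / (1 - r ^ 2 * Real.cos ξ ^ 2) := by
    rw [groupVelocity, div_pow, Real.sq_sqrt hp.le, mul_pow, Real.sin_sq]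
    field_simp
    ring
  rw [groupVelocityInv, h5, Real.sqrt_div h4.le, groupVelocity]
  have := Real.sqrt_pos.2 hp
  have := Real.sqrt_pos.2 h4
  have e : √(1 - r ^ 2) / r * (r * Real.sin ξ / √(1 - r ^ 2 * Real.cos ξ ^ 2) /
      (√(1 - r ^ 2) / √(1 - r ^ 2 * Real.cos ξ ^ 2))) = Real.sin ξ := by
    field_simp
  rw [e, Real.arcsin_sin hξ.1.le hξ.2.le]

lemma image_groupVelocityInv (hr : 0 < r) (hr1 : r < 1) :
    groupVelocityInv r '' Set.Ioo (-r) r = Set.Ioo (-(Real.pi / 2)) (Real.pi / 2) := by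
  ext ξ
  constructor
  · rintro ⟨x, hx, rfl⟩
    exact groupVelocityInv_mem_Ioo hr hr1 hx
  · intro hξ
    exact ⟨_, groupVelocity_mem_Ioo hr hr1 hξ, groupVelocityInv_groupVelocity hr hr1 hξ⟩

lemma injOn_groupVelocityInv (hr : 0 < r) (hr1 : r < 1) :
    Set.InjOn (groupVelocityInv r) (Set.Ioo (-r) r) :=
  Set.LeftInvOn.injOn fun _ hx => groupVelocity_groupVelocityInv hr hr1 hx

lemma hasDerivAt_groupVelocityInv (hr : 0 < r) (hr1 : r < 1) {x : ℝ} (hx : x ∈ Set.Ioo (-r) r) :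
    HasDerivAt (groupVelocityInv r) (arcWeight r x) x := by
  have h1 := sq_lt_sq_of_mem_Ioo hx
  have h2 : r ^ 2 < 1 := by nlinarith
  have h3 : 0 < 1 - x ^ 2 := by linarith
  have h6 : 0 < r ^ 2 - x ^ 2 := by linarith
  have h := groupVelocityArg_mem_Ioo hr hr1 hx
  have hs := Real.sqrt_pos.2 h3
  have hd : HasDerivAt (fun y : ℝ => √(1 - r ^ 2) / r * (y / √(1 - y ^ 2)))
      (√(1 - r ^ 2) / r * (1 / ((1 - x ^ 2) * √(1 - x ^ 2)))) x := by
    have hq : HasDerivAt (fun y : ℝ => √(1 - y ^ 2)) (-(2 * x) / (2 * √(1 - x ^ 2))) x := by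
      refine HasDerivAt.sqrt ?_ h3.ne'
      simpa using ((hasDerivAt_id x).pow 2).const_sub 1
    refine (((hasDerivAt_id' x).div hq hs.ne').congr_deriv ?_).const_mul _
    have hsq := Real.sq_sqrt h3.le
    rw [hsq]
    field_simp
    linarith
  refine ((Real.hasDerivAt_arcsin h.1.ne' h.2.ne).comp x hd).congr_deriv ?_
  rw [one_sub_sq_groupVelocityArg hr hr1 hx, Real.sqrt_div h6.le, Real.sqrt_mul (sq_nonneg r),
    Real.sqrt_sq hr.le, arcWeight]
  have := Real.sqrt_pos.2 h6
  field_simp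

lemma arcWeight_nonneg (hr1 : r < 1) {x : ℝ} (hx : x ∈ Set.Ioo (-r) r) :
    0 ≤ arcWeight r x := by
  have hr : 0 < r := by linarith [hx.1, hx.2]
  have h1 := sq_lt_sq_of_mem_Ioo hx
  have h2 : r ^ 2 < 1 := by nlinarith
  have h3 : 0 < 1 - x ^ 2 := by linarith
  unfold arcWeight
  positivity

/-! ### Substitution of the velocity for the wave number -/

variable {E : Type*} [NormedAddCommGroup E] [NormedSpace ℝ E]

lemma integral_arcWeight_smul (hr : 0 < r) (hr1 : r < 1) (g : ℝ → E) :
    ∫ x in Set.Ioo (-r) r, arcWeight r x • g x =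
      ∫ ξ in Set.Ioo (-(Real.pi / 2)) (Real.pi / 2), g (groupVelocity r ξ) := by
  rw [← image_groupVelocityInv hr hr1, integral_image_eq_integral_abs_deriv_smul measurableSet_Ioo
    (fun x hx => (hasDerivAt_groupVelocityInv hr hr1 hx).hasDerivWithinAt)
    (injOn_groupVelocityInv hr hr1)]
  refine setIntegral_congr_fun measurableSet_Ioo fun x hx => ?_
  simp only [groupVelocity_groupVelocityInv hr hr1 hx, abs_of_nonneg (arcWeight_nonneg hr1 hx)]

/-- The weight blows up at `±r`, but after the substitution the integrand is continuous on a bounded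
interval. -/
lemma integrableOn_arcWeight_smul (hr : 0 < r) (hr1 : r < 1) {g : ℝ → E} (hg : Continuous g) :
    IntegrableOn (fun x => arcWeight r x • g x) (Set.Ioo (-r) r) := by
  have hcont : IntegrableOn (fun ξ => g (groupVelocity r ξ))
      (Set.Ioo (-(Real.pi / 2)) (Real.pi / 2)) :=
    ((hg.comp (continuous_groupVelocity hr hr1)).integrableOn_Icc).mono_set Set.Ioo_subset_Icc_self
  rw [← image_groupVelocityInv hr hr1, integrableOn_image_iff_integrableOn_abs_deriv_smul
    measurableSet_Ioo (fun x hx => (hasDerivAt_groupVelocityInv hr hr1 hx).hasDerivWithinAt)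
    (injOn_groupVelocityInv hr hr1)] at hcont
  refine hcont.congr_fun (fun x hx => ?_) measurableSet_Ioo
  simp only [groupVelocity_groupVelocityInv hr hr1 hx, abs_of_nonneg (arcWeight_nonneg hr1 hx)]

/-- The arcsine law on `(-r, r)` has total mass `π`. -/
lemma integral_one_div_sqrt_sq_sub_sq (hr : 0 < r) :
    ∫ x in Set.Ioo (-r) r, 1 / √(r ^ 2 - x ^ 2) = Real.pi ∧
      IntegrableOn (fun x => 1 / √(r ^ 2 - x ^ 2)) (Set.Ioo (-r) r) := by
  have hmem : ∀ x ∈ Set.Ioo (-r) r, x / r ∈ Set.Ioo (-1 : ℝ) 1 := fun x hx => by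
    rw [Set.mem_Ioo, lt_div_iff₀ hr, div_lt_iff₀ hr]
    constructor <;> linarith [hx.1, hx.2]
  have hd : ∀ x ∈ Set.Ioo (-r) r, HasDerivWithinAt (fun y => Real.arcsin (y / r))
      (1 / √(r ^ 2 - x ^ 2)) (Set.Ioo (-r) r) x := fun x hx => by
    have h1 := sq_lt_sq_of_mem_Ioo hx
    have h6 : 0 < r ^ 2 - x ^ 2 := by linarith
    have h := (Real.hasDerivAt_arcsin (hmem x hx).1.ne' (hmem x hx).2.ne).comp x
      ((hasDerivAt_id' x).div_const r)
    refine (h.congr_deriv ?_).hasDerivWithinAt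
    have e : 1 - (x / r) ^ 2 = (r ^ 2 - x ^ 2) / r ^ 2 := by field_simp
    rw [e, Real.sqrt_div h6.le, Real.sqrt_sq hr.le]
    field_simp
  have hinj : Set.InjOn (fun y => Real.arcsin (y / r)) (Set.Ioo (-r) r) := by
    refine Set.LeftInvOn.injOn (f₁' := fun ξ => r * Real.sin ξ) fun x hx => ?_
    simp only [Real.sin_arcsin (hmem x hx).1.le (hmem x hx).2.le]
    field_simp
  have himg : (fun y => Real.arcsin (y / r)) '' Set.Ioo (-r) r =
      Set.Ioo (-(Real.pi / 2)) (Real.pi / 2) := by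
    ext ξ
    constructor
    · rintro ⟨x, hx, rfl⟩
      exact ⟨Real.neg_pi_div_two_lt_arcsin.2 (hmem x hx).1,
        Real.arcsin_lt_pi_div_two.2 (hmem x hx).2⟩
    · intro hξ
      have hc : 0 < Real.cos ξ := Real.cos_pos_of_mem_Ioo hξ
      have hs : |Real.sin ξ| < 1 := by
        rw [← sq_lt_one_iff_abs_lt_one, Real.sin_sq]
        nlinarith
      refine ⟨r * Real.sin ξ, ?_, ?_⟩
      · rw [Set.mem_Ioo, ← abs_lt, abs_mul, abs_of_pos hr]
        nlinarith
      · simp only [mul_div_cancel_left₀ _ hr.ne', Real.arcsin_sin hξ.1.le hξ.2.le]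
  constructor
  -- Applied to the constant 1, the change of variables gives the length `π` of the image of `arcsin
  -- (x / r)`.
  · have h := integral_image_eq_integral_abs_deriv_smul measurableSet_Ioo hd hinj
      (fun _ => (1 : ℝ))
    rw [himg] at h
    simp only [smul_eq_mul, mul_one, abs_of_nonneg (one_div_nonneg.2 (Real.sqrt_nonneg _))] at h
    rw [← h]
    simp [Real.pi_pos.le]
  · have h := integrableOn_image_iff_integrableOn_abs_deriv_smul measurableSet_Ioo hd hinj
      (fun _ => (1 : ℝ))
    rw [himg] at h
    simp only [smul_eq_mul, mul_one, abs_of_nonneg (one_div_nonneg.2 (Real.sqrt_nonneg _))] at h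
    exact h.1 (integrableOn_const (by simp))

/-- The mean square of the group velocity. -/
lemma integral_sq_groupVelocity (hr : 0 < r) (hr1 : r < 1) :
    ∫ ξ in Set.Ioo (-(Real.pi / 2)) (Real.pi / 2), groupVelocity r ξ ^ 2 =
      Real.pi * (1 - √(1 - r ^ 2)) := by
  obtain ⟨hI, hint⟩ := integral_one_div_sqrt_sq_sub_sq hr
  have hmass : ∫ x in Set.Ioo (-r) r, arcWeight r x = Real.pi := by
    have := integral_arcWeight_smul hr hr1 (fun _ => (1 : ℝ))
    simpa [Real.pi_pos.le] using this
  have hw : IntegrableOn (arcWeight r) (Set.Ioo (-r) r) := by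
    simpa using integrableOn_arcWeight_smul hr hr1 (continuous_const (y := (1 : ℝ)))
  rw [← integral_arcWeight_smul hr hr1 (fun x => x ^ 2)]
  -- Write `x² = 1 - (1 - x²)`: the second term cancels the factor `1 - x²` of the weight and leaves
  -- the arcsine density.
  have hsplit : ∀ x ∈ Set.Ioo (-r) r, arcWeight r x • x ^ 2 =
      arcWeight r x - √(1 - r ^ 2) * (1 / √(r ^ 2 - x ^ 2)) := fun x hx => by
    have h1 := sq_lt_sq_of_mem_Ioo hx
    have h2 : r ^ 2 < 1 := by nlinarith
    have h3 : 0 < 1 - x ^ 2 := by linarith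
    have h6 : 0 < r ^ 2 - x ^ 2 := by linarith
    have := Real.sqrt_pos.2 h6
    rw [arcWeight, smul_eq_mul]
    field_simp
    ring
  rw [setIntegral_congr_fun measurableSet_Ioo hsplit, integral_sub hw (hint.const_mul _),
    integral_const_mul, hmass, hI]
  ring

end

/-! ### The limit law -/

section

variable {r κ : ℝ}

/-- The density `κ`-tilting the arcsine-type law with parameter `r`. -/
def arcDensity (r κ : ℝ) : ℝ → ℝ :=
  (Set.Ioo (-r) r).indicator fun x => Real.pi⁻¹ * (arcWeight r x * (1 - κ * x))

lemma limitDensity_eq_arcDensity (j : WalkType) (U : Matrix (Fin 2) (Fin 2) ℂ) (φ : Fin 2 → ℂ) :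
    limitDensity j U φ = arcDensity ‖U 0 0‖ (asymmetry j U φ) := by
  funext x
  by_cases hx : x ∈ Set.Ioo (-‖U 0 0‖) ‖U 0 0‖
  · rw [limitDensity, if_pos hx, arcDensity, Set.indicator_of_mem hx, arcWeight]
    simp only [div_eq_mul_inv, mul_inv]
    ring
  · rw [limitDensity, if_neg hx, arcDensity, Set.indicator_of_notMem hx]

/-- The factor `1 - κ x` is affine, so it suffices to control it at `±r`, which is what `|r κ| ≤ 1`
does. -/
lemma arcDensity_nonneg (hr1 : r < 1) (hκ : |r * κ| ≤ 1) (x : ℝ) : 0 ≤ arcDensity r κ x := by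
  refine Set.indicator_nonneg (fun x hx => ?_) x
  have hw := arcWeight_nonneg hr1 hx
  have h1 : κ * x ≤ 1 := by
    have hx' : |x| ≤ r := (abs_lt.2 hx).le
    calc κ * x ≤ |κ * x| := le_abs_self _
      _ = |κ| * |x| := abs_mul _ _
      _ ≤ |κ| * r := by gcongr
      _ ≤ |κ| * |r| := by gcongr; exact le_abs_self r
      _ = |r * κ| := by rw [abs_mul, mul_comm]
      _ ≤ 1 := hκ
  have := Real.pi_pos
  have : 0 ≤ 1 - κ * x := by linarith
  positivity

lemma measurable_arcDensity (r κ : ℝ) : Measurable (arcDensity r κ) := by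
  refine Measurable.indicator ?_ measurableSet_Ioo
  unfold arcWeight
  fun_prop

variable {E : Type*} [NormedAddCommGroup E] [NormedSpace ℝ E]

lemma integral_arcDensity_smul (hr : 0 < r) (hr1 : r < 1) (g : ℝ → E) :
    ∫ x, arcDensity r κ x • g x = Real.pi⁻¹ •
      ∫ ξ in Set.Ioo (-(Real.pi / 2)) (Real.pi / 2),
        (1 - κ * groupVelocity r ξ) • g (groupVelocity r ξ) := by
  rw [← integral_arcWeight_smul hr hr1 (fun x => (1 - κ * x) • g x), ← integral_smul,
    ← integral_indicator measurableSet_Ioo]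
  refine integral_congr_ae (ae_of_all _ fun x => ?_)
  by_cases hx : x ∈ Set.Ioo (-r) r
  · simp [arcDensity, hx, smul_smul]
  · simp [arcDensity, hx]

lemma integrable_arcDensity_smul (hr : 0 < r) (hr1 : r < 1) {g : ℝ → E} (hg : Continuous g) :
    Integrable fun x => arcDensity r κ x • g x := by
  have h := integrableOn_arcWeight_smul hr hr1 (g := fun x => Real.pi⁻¹ • (1 - κ * x) • g x)
    (by fun_prop)
  rw [← integrable_indicator_iff measurableSet_Ioo] at h
  refine h.congr (ae_of_all _ fun x => ?_)
  by_cases hx : x ∈ Set.Ioo (-r) r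
  · simp only [Set.indicator_of_mem hx, arcDensity, smul_smul]
    congr 1
    ring
  · simp [arcDensity, hx]

lemma setIntegral_Ioo_of_odd {a : ℝ} (ha : 0 ≤ a) {f : ℝ → E} (hf : ∀ x, f (-x) = -f x) :
    ∫ x in Set.Ioo (-a) a, f x = 0 := by
  rw [← integral_Ioc_eq_integral_Ioo, ← intervalIntegral.integral_of_le (by linarith)]
  have h := intervalIntegral.integral_comp_neg (a := -a) (b := a) f
  simp only [hf, neg_neg, intervalIntegral.integral_neg] at h
  have h2 : (2 : ℝ) • ∫ x in (-a)..a, f x = 0 := by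
    rw [two_smul]
    nth_rewrite 1 [← h]
    exact neg_add_cancel _
  exact (smul_eq_zero.1 h2).resolve_left two_ne_zero

/-- The law with density `arcDensity r κ`. -/
def arcLaw (r κ : ℝ) : Measure ℝ := volume.withDensity fun x => ENNReal.ofReal (arcDensity r κ x)

/-- The law is the image under `v` of `(1 - κ v)/π` on the half period; mass, moments and
characteristic function are all computed in this form. -/
lemma integral_arcLaw (hr : 0 < r) (hr1 : r < 1) (hκ : |r * κ| ≤ 1) (g : ℝ → E) :
    ∫ x, g x ∂arcLaw r κ = Real.pi⁻¹ •
      ∫ ξ in Set.Ioo (-(Real.pi / 2)) (Real.pi / 2),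
        (1 - κ * groupVelocity r ξ) • g (groupVelocity r ξ) := by
  rw [arcLaw, integral_withDensity_eq_integral_toReal_smul
    (measurable_arcDensity r κ).ennreal_ofReal (ae_of_all _ fun _ => ENNReal.ofReal_lt_top),
    ← integral_arcDensity_smul hr hr1]
  simp only [ENNReal.toReal_ofReal (arcDensity_nonneg hr1 hκ _)]

lemma integrable_arcLaw (hr : 0 < r) (hr1 : r < 1) (hκ : |r * κ| ≤ 1) {g : ℝ → E}
    (hg : Continuous g) : Integrable g (arcLaw r κ) := by
  rw [arcLaw, integrable_withDensity_iff_integrable_smul'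
    (measurable_arcDensity r κ).ennreal_ofReal (ae_of_all _ fun _ => ENNReal.ofReal_lt_top)]
  simp only [ENNReal.toReal_ofReal (arcDensity_nonneg hr1 hκ _)]
  exact integrable_arcDensity_smul hr hr1 hg

/-- The tilt `κ v` is odd and contributes no mass. -/
lemma isProbabilityMeasure_arcLaw (hr : 0 < r) (hr1 : r < 1) (hκ : |r * κ| ≤ 1) :
    IsProbabilityMeasure (arcLaw r κ) := by
  have hfin : IsFiniteMeasure (arcLaw r κ) := by
    have := integrable_arcLaw hr hr1 hκ (continuous_const (y := (1 : ℝ)))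
    exact (integrable_const_iff_isFiniteMeasure one_ne_zero).1 this
  have h := integral_arcLaw hr hr1 hκ (fun _ => (1 : ℝ))
  have hv := (continuous_groupVelocity hr hr1).integrableOn_Icc (μ := volume)
    (a := -(Real.pi / 2)) (b := Real.pi / 2)
  have hv' := hv.mono_set Set.Ioo_subset_Icc_self
  simp only [smul_eq_mul, mul_one] at h
  rw [integral_sub (integrable_const _) (hv'.const_mul κ), integral_const_mul,
    setIntegral_Ioo_of_odd (by positivity) (groupVelocity_neg r)] at h
  constructor
  have h1 : (arcLaw r κ).real Set.univ = 1 := by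
    simpa [Real.pi_pos.le, Real.pi_ne_zero] using h
  rw [← ENNReal.ofReal_one, ← h1, ofReal_measureReal]

/-- The tilt contributes `κ v³`, which is odd, so the second moment is independent of `κ`. -/
lemma integral_sq_arcLaw (hr : 0 < r) (hr1 : r < 1) (hκ : |r * κ| ≤ 1) :
    ∫ x, x ^ 2 ∂arcLaw r κ = 1 - √(1 - r ^ 2) := by
  have hc := continuous_groupVelocity hr hr1
  have h2 : IntegrableOn (fun ξ => groupVelocity r ξ ^ 2)
      (Set.Ioo (-(Real.pi / 2)) (Real.pi / 2)) :=
    (hc.pow 2).integrableOn_Icc.mono_set Set.Ioo_subset_Icc_self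
  have h3 : IntegrableOn (fun ξ => κ * groupVelocity r ξ ^ 3)
      (Set.Ioo (-(Real.pi / 2)) (Real.pi / 2)) :=
    (continuous_const.mul (hc.pow 3)).integrableOn_Icc.mono_set Set.Ioo_subset_Icc_self
  rw [integral_arcLaw hr hr1 hκ]
  have e : ∀ ξ, (1 - κ * groupVelocity r ξ) • groupVelocity r ξ ^ 2 =
      groupVelocity r ξ ^ 2 - κ * groupVelocity r ξ ^ 3 := fun ξ => by
    rw [smul_eq_mul]; ring
  simp only [e]
  rw [integral_sub h2 h3, integral_sq_groupVelocity hr hr1, setIntegral_Ioo_of_odd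
    (f := fun ξ => κ * groupVelocity r ξ ^ 3) (by positivity)
    (fun ξ => by rw [groupVelocity_neg]; ring), smul_eq_mul, sub_zero,
    inv_mul_cancel_left₀ Real.pi_ne_zero]

/-- Here only the tilt survives: `v` is odd, and `-κ v²` remains. -/
lemma integral_id_arcLaw (hr : 0 < r) (hr1 : r < 1) (hκ : |r * κ| ≤ 1) :
    ∫ x, x ∂arcLaw r κ = -κ * (1 - √(1 - r ^ 2)) := by
  have hc := continuous_groupVelocity hr hr1
  have h2 : IntegrableOn (fun ξ => κ * groupVelocity r ξ ^ 2)
      (Set.Ioo (-(Real.pi / 2)) (Real.pi / 2)) :=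
    (continuous_const.mul (hc.pow 2)).integrableOn_Icc.mono_set Set.Ioo_subset_Icc_self
  have h1 : IntegrableOn (fun ξ => groupVelocity r ξ)
      (Set.Ioo (-(Real.pi / 2)) (Real.pi / 2)) :=
    hc.integrableOn_Icc.mono_set Set.Ioo_subset_Icc_self
  rw [integral_arcLaw hr hr1 hκ]
  have e : ∀ ξ, (1 - κ * groupVelocity r ξ) • groupVelocity r ξ =
      groupVelocity r ξ - κ * groupVelocity r ξ ^ 2 := fun ξ => by
    rw [smul_eq_mul]; ring
  simp only [e]
  rw [integral_sub h1 h2, integral_const_mul, integral_sq_groupVelocity hr hr1,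
    setIntegral_Ioo_of_odd (by positivity) (groupVelocity_neg r), smul_eq_mul]
  field_simp [Real.pi_ne_zero]
  ring

/-- The characteristic function of the limit law as an integral over half a period. -/
lemma charFun_arcLaw (hr : 0 < r) (hr1 : r < 1) (hκ : |r * κ| ≤ 1) (t : ℝ) :
    charFun (arcLaw r κ) t = (Real.pi : ℂ)⁻¹ * ∫ ξ in (-(Real.pi / 2))..(Real.pi / 2),
      ((Real.cos (t * groupVelocity r ξ) : ℂ) -
        Complex.I * (κ * groupVelocity r ξ * Real.sin (t * groupVelocity r ξ) : ℝ)) := by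
  have hc := continuous_groupVelocity hr hr1
  rw [charFun_apply_real, integral_arcLaw hr hr1 hκ, Complex.real_smul, Complex.ofReal_inv,
    intervalIntegral.integral_of_le (by linarith [Real.pi_pos]), integral_Ioc_eq_integral_Ioo]
  congr 1
  -- Splitting into the even and the odd part in `ξ`; the odd one integrates to zero.
  have e : ∀ ξ, (1 - κ * groupVelocity r ξ) • Complex.exp (t * (groupVelocity r ξ : ℂ) * Complex.I)
      = ((Real.cos (t * groupVelocity r ξ) : ℂ) -
        Complex.I * (κ * groupVelocity r ξ * Real.sin (t * groupVelocity r ξ) : ℝ)) +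
        (Complex.I * (Real.sin (t * groupVelocity r ξ) : ℝ) -
          (κ * groupVelocity r ξ * Real.cos (t * groupVelocity r ξ) : ℝ)) := fun ξ => by
    rw [Complex.exp_mul_I, Complex.real_smul]
    push_cast
    ring
  simp only [e]
  rw [integral_add, setIntegral_Ioo_of_odd (f := fun ξ =>
    (Complex.I * (Real.sin (t * groupVelocity r ξ) : ℝ) -
          (κ * groupVelocity r ξ * Real.cos (t * groupVelocity r ξ) : ℝ) : ℂ))
    (by positivity) (fun ξ => ?_), add_zero]
  · rw [groupVelocity_neg]
    simp only [mul_neg, Real.sin_neg, Real.cos_neg, neg_mul, Complex.ofReal_neg]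
    ring
  · exact (Continuous.integrableOn_Icc (by fun_prop)).mono_set Set.Ioo_subset_Icc_self
  · exact (Continuous.integrableOn_Icc (by fun_prop)).mono_set Set.Ioo_subset_Icc_self

end

/-! ### Fourier analysis of the walk -/

section

variable (j : WalkType) (U : Matrix (Fin 2) (Fin 2) ℂ) (φ : Fin 2 → ℂ)

/-- Multiplying the two halves of the coin by phases does not change the location of the walk. -/
lemma locationProb_eq_of_phase {U' : Matrix (Fin 2) (Fin 2) ℂ} {l m : ℂ} (hl : ‖l‖ = 1)
    (hm : ‖m‖ = 1) (hL : leftMatrix j U = l • leftMatrix j U')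
    (hR : rightMatrix j U = m • rightMatrix j U') (n : ℕ) (k : ℤ) :
    locationProb j U φ n k = locationProb j U' φ n k := by
  have hl0 : l ≠ 0 := norm_ne_zero_iff.1 (by simp [hl])
  have hm0 : m ≠ 0 := norm_ne_zero_iff.1 (by simp [hm])
  -- With `w² = l m`, the two amplitudes differ by the unimodular factor `wⁿ (w/l)ᵏ`: both `l ·
  -- (w/l)` and `m · (w/l)⁻¹` equal `w`, so left and right moves pick up the same factor per step.
  obtain ⟨w, hw'⟩ := IsAlgClosed.exists_pow_nat_eq (l * m) two_pos
  have hw := hw'.symm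
  have hw1 : ‖w‖ = 1 := by
    have : ‖w‖ ^ 2 = 1 := by rw [← norm_pow, ← hw, norm_mul, hl, hm, one_mul]
    nlinarith [norm_nonneg w]
  have hw0 : w ≠ 0 := norm_ne_zero_iff.1 (by simp [hw1])
  have hz0 : w / l ≠ 0 := div_ne_zero hw0 hl0
  have key : ∀ (n : ℕ) (k : ℤ),
      amplitude j U φ n k = (w ^ n * (w / l) ^ k) • amplitude j U' φ n k := by
    intro n
    induction n with
    | zero =>
      intro k
      by_cases hk : k = 0 <;> simp [amplitude, hk]
    | succ n ih =>
      intro k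
      have e1 : l * (w ^ n * (w / l) ^ (k + 1)) = w ^ (n + 1) * (w / l) ^ k := by
        rw [zpow_add_one₀ hz0, pow_succ]
        field_simp
      have e2 : m * (w ^ n * (w / l) ^ (k - 1)) = w ^ (n + 1) * (w / l) ^ k := by
        rw [zpow_sub_one₀ hz0, inv_div, pow_succ]
        field_simp
        rw [← hw]
        ring
      simp only [amplitude]
      rw [ih, ih, hL, hR, Matrix.mulVec_smul, Matrix.mulVec_smul, Matrix.smul_mulVec,
        Matrix.smul_mulVec, smul_smul, smul_smul, mul_comm _ l, mul_comm _ m, e1, e2, smul_add]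
  have hn : ‖w ^ n * (w / l) ^ k‖ = 1 := by simp [hw1, hl]
  simp only [locationProb, key n k, Pi.smul_apply, norm_smul, hn, one_mul]

lemma amplitude_eq_zero (n : ℕ) (k : ℤ) (hk : k ∉ Finset.Icc (-(n : ℤ)) n) :
    amplitude j U φ n k = 0 := by
  induction n generalizing k with
  | zero =>
    have : k ≠ 0 := by rintro rfl; simp at hk
    simp [amplitude, this]
  | succ n ih =>
    simp only [Finset.mem_Icc, Nat.cast_add, Nat.cast_one] at hk ih
    simp only [amplitude]
    rw [ih (k + 1) (by omega), ih (k - 1) (by omega)]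
    simp

/-- The Fourier symbol of one step of the walk. -/
def symbol (ξ : ℝ) : Matrix (Fin 2) (Fin 2) ℂ :=
  Complex.exp (-(ξ * Complex.I)) • leftMatrix j U + Complex.exp (ξ * Complex.I) • rightMatrix j U

/-- A shift by one site becomes a factor `e^{±iξ}`. Summing over all of `ℤ` makes the shifts mere
reindexings; finite propagation then yields the finite sum of `symbol_pow_mulVec`. -/
lemma hasSum_exp_mul_amplitude (n : ℕ) (ξ : ℝ) (i : Fin 2) :
    HasSum (fun k : ℤ => Complex.exp (k * (ξ * Complex.I)) * amplitude j U φ n k i)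
      ((symbol j U ξ ^ n *ᵥ φ) i) := by
  induction n generalizing i with
  | zero =>
    have h := hasSum_single (f := fun k : ℤ =>
      Complex.exp (k * (ξ * Complex.I)) * amplitude j U φ 0 k i) 0 fun k hk => by
        simp [amplitude, hk]
    simpa [amplitude] using h
  | succ n ih =>
    have hl : ∀ l, HasSum (fun k : ℤ => Complex.exp (-(ξ * Complex.I)) * leftMatrix j U i l *
        (Complex.exp ((k + 1 : ℤ) * (ξ * Complex.I)) * amplitude j U φ n (k + 1) l))
        (Complex.exp (-(ξ * Complex.I)) * leftMatrix j U i l * (symbol j U ξ ^ n *ᵥ φ) l) :=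
      fun l => ((Equiv.addRight (1 : ℤ)).hasSum_iff.mpr (ih l)).mul_left _
    have hr : ∀ l, HasSum (fun k : ℤ => Complex.exp (ξ * Complex.I) * rightMatrix j U i l *
        (Complex.exp ((k - 1 : ℤ) * (ξ * Complex.I)) * amplitude j U φ n (k - 1) l))
        (Complex.exp (ξ * Complex.I) * rightMatrix j U i l * (symbol j U ξ ^ n *ᵥ φ) l) :=
      fun l => ((Equiv.subRight (1 : ℤ)).hasSum_iff.mpr (ih l)).mul_left _
    convert ((hl 0).add (hl 1)).add ((hr 0).add (hr 1)) using 1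
    · funext k
      have e1 : Complex.exp ((k + 1 : ℤ) * (ξ * Complex.I)) =
          Complex.exp (k * (ξ * Complex.I)) * Complex.exp (ξ * Complex.I) := by
        rw [← Complex.exp_add]; push_cast; ring_nf
      have e2 : Complex.exp ((k - 1 : ℤ) * (ξ * Complex.I)) =
          Complex.exp (k * (ξ * Complex.I)) * Complex.exp (-(ξ * Complex.I)) := by
        rw [← Complex.exp_add]; push_cast; ring_nf
      have e3 : Complex.exp (-(ξ * Complex.I)) * Complex.exp (ξ * Complex.I) = 1 := by
        rw [← Complex.exp_add]; simp
      rw [e1, e2]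
      simp only [amplitude, Matrix.mulVec, dotProduct, Fin.sum_univ_two, Pi.add_apply]
      linear_combination (-Complex.exp (k * (ξ * Complex.I)) *
        (leftMatrix j U i 0 * amplitude j U φ n (k + 1) 0 +
          leftMatrix j U i 1 * amplitude j U φ n (k + 1) 1 +
          rightMatrix j U i 0 * amplitude j U φ n (k - 1) 0 +
          rightMatrix j U i 1 * amplitude j U φ n (k - 1) 1)) * e3
    · rw [pow_succ', ← Matrix.mulVec_mulVec]
      generalize symbol j U ξ ^ n *ᵥ φ = v
      simp only [symbol, Matrix.mulVec, dotProduct, Fin.sum_univ_two, Matrix.add_apply,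
        Matrix.smul_apply, smul_eq_mul]
      ring

lemma symbol_pow_mulVec (n : ℕ) (ξ : ℝ) (i : Fin 2) :
    (symbol j U ξ ^ n *ᵥ φ) i =
      ∑ k ∈ Finset.Icc (-(n : ℤ)) n, Complex.exp (k * (ξ * Complex.I)) * amplitude j U φ n k i :=
  (hasSum_exp_mul_amplitude j U φ n ξ i).unique <| hasSum_sum_of_ne_finset_zero fun k hk => by
    simp [amplitude_eq_zero j U φ n k hk]

end

/-! ### Orthogonality of exponentials and Parseval -/

lemma integral_exp_int_mul_I (a : ℝ) (m : ℤ) :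
    ∫ ξ in a..(a + 2 * Real.pi), Complex.exp (m * (ξ * Complex.I)) =
      if m = 0 then (2 * Real.pi : ℂ) else 0 := by
  split_ifs with hm
  · simp [hm]
  · have hm' : (m * Complex.I : ℂ) ≠ 0 := by simp [hm]
    have e : ∀ ξ : ℝ, (m * (ξ * Complex.I) : ℂ) = m * Complex.I * ξ := fun ξ => by ring
    simp only [e]
    rw [integral_exp_mul_complex hm']
    have h : Complex.exp (m * Complex.I * ((a + 2 * Real.pi : ℝ) : ℂ)) =
        Complex.exp (m * Complex.I * a) := by
      rw [← Complex.exp_periodic.int_mul m (m * Complex.I * a)]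
      push_cast
      ring_nf
    rw [h, sub_self, zero_div]

/-- Parseval's identity for trigonometric polynomials. -/
lemma integral_conj_mul_trigPoly (a : ℝ) (S : Finset ℤ) (f g : ℤ → ℂ) :
    ∫ ξ in a..(a + 2 * Real.pi), conj (∑ k ∈ S, Complex.exp (k * (ξ * Complex.I)) * f k) *
        ∑ k ∈ S, Complex.exp (k * (ξ * Complex.I)) * g k =
      2 * Real.pi * ∑ k ∈ S, conj (f k) * g k := by
  have e : ∀ ξ : ℝ, conj (∑ k ∈ S, Complex.exp (k * (ξ * Complex.I)) * f k) *
        ∑ k ∈ S, Complex.exp (k * (ξ * Complex.I)) * g k =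
      ∑ k ∈ S, ∑ l ∈ S, Complex.exp ((l - k : ℤ) * (ξ * Complex.I)) * (conj (f k) * g l) := by
    intro ξ
    rw [map_sum, Finset.sum_mul_sum]
    refine Finset.sum_congr rfl fun k _ => Finset.sum_congr rfl fun l _ => ?_
    have : Complex.exp ((l - k : ℤ) * (ξ * Complex.I)) =
        conj (Complex.exp (k * (ξ * Complex.I))) * Complex.exp (l * (ξ * Complex.I)) := by
      rw [← Complex.exp_conj, ← Complex.exp_add]
      simp only [map_mul, map_intCast, Complex.conj_ofReal, Complex.conj_I]
      push_cast
      ring_nf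
    rw [this, map_mul]
    ring
  simp only [e]
  rw [intervalIntegral.integral_finsetSum
    fun k _ => Continuous.intervalIntegrable (by fun_prop) _ _, Finset.mul_sum]
  refine Finset.sum_congr rfl fun k hk => ?_
  rw [intervalIntegral.integral_finsetSum
    fun l _ => Continuous.intervalIntegrable (by fun_prop) _ _]
  simp only [intervalIntegral.integral_mul_const, integral_exp_int_mul_I, sub_eq_zero, ite_mul,
    zero_mul]
  rw [Finset.sum_ite_eq' S k, if_pos hk]

/-- Weighting the amplitude by `e^{ikh}` translates its transform by `h`; Parseval then pairs the
transforms at `ξ` and `ξ + h`. -/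
lemma sum_locationProb_mul_exp (j : WalkType) (U : Matrix (Fin 2) (Fin 2) ℂ) (φ : Fin 2 → ℂ)
    (n : ℕ) (a h : ℝ) :
    ∑ k ∈ Finset.Icc (-(n : ℤ)) n,
        (locationProb j U φ n k : ℂ) * Complex.exp (k * (h * Complex.I)) =
      (2 * Real.pi : ℂ)⁻¹ * ∫ ξ in a..(a + 2 * Real.pi),
        (conj ((symbol j U ξ ^ n *ᵥ φ) 0) * (symbol j U (ξ + h) ^ n *ᵥ φ) 0 +
          conj ((symbol j U ξ ^ n *ᵥ φ) 1) * (symbol j U (ξ + h) ^ n *ᵥ φ) 1) := by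
  have hpi : (2 * Real.pi : ℂ) ≠ 0 := by simp [Real.pi_ne_zero]
  have hc : ∀ ξ i, (symbol j U (ξ + h) ^ n *ᵥ φ) i = ∑ k ∈ Finset.Icc (-(n : ℤ)) n,
      Complex.exp (k * (ξ * Complex.I)) *
        (Complex.exp (k * (h * Complex.I)) * amplitude j U φ n k i) := fun ξ i => by
    rw [symbol_pow_mulVec]
    refine Finset.sum_congr rfl fun k _ => ?_
    rw [← mul_assoc (Complex.exp _) (Complex.exp _), ← Complex.exp_add]
    push_cast
    ring_nf
  simp only [hc, symbol_pow_mulVec j U φ n _]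
  rw [intervalIntegral.integral_add (Continuous.intervalIntegrable (by fun_prop) _ _)
    (Continuous.intervalIntegrable (by fun_prop) _ _), integral_conj_mul_trigPoly,
    integral_conj_mul_trigPoly, ← mul_add, inv_mul_cancel_left₀ hpi, ← Finset.sum_add_distrib]
  refine Finset.sum_congr rfl fun k _ => ?_
  rw [locationProb]
  push_cast
  rw [← Complex.conj_mul', ← Complex.conj_mul']
  ring

/-! ### Asymptotics of the normalised symbol -/

/-- A matrix satisfying the Cayley–Hamilton identity of a rotation by the angle `θ` has the powers
of such a rotation. -/
lemma pow_eq_of_mul_self_eq {M : Matrix (Fin 2) (Fin 2) ℂ} {θ : ℝ} (hθ : Real.sin θ ≠ 0)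
    (hM : M * M = (2 * Real.cos θ : ℂ) • M - 1) (n : ℕ) :
    M ^ n = (Real.cos (n * θ) : ℂ) • (1 : Matrix (Fin 2) (Fin 2) ℂ) +
      (Real.sin (n * θ) / Real.sin θ : ℂ) • (M - (Real.cos θ : ℂ) • 1) := by
  have hθ' : (Real.sin θ : ℂ) ≠ 0 := Complex.ofReal_ne_zero.2 hθ
  -- By `hM`, `J = (M - cos θ)/sin θ` satisfies `J² = -1`, so the claim is de Moivre's formula for
  -- `cos θ + J sin θ`.
  induction n with
  | zero => simp
  | succ n ih =>
    have hs : (Real.sin ((n + 1 : ℕ) * θ) : ℂ) =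
        Real.sin (n * θ) * Real.cos θ + Real.cos (n * θ) * Real.sin θ := by
      rw [Nat.cast_add, Nat.cast_one, add_mul, one_mul, Real.sin_add]
      push_cast
      ring
    have hc : (Real.cos ((n + 1 : ℕ) * θ) : ℂ) =
        Real.cos (n * θ) * Real.cos θ - Real.sin (n * θ) * Real.sin θ := by
      rw [Nat.cast_add, Nat.cast_one, add_mul, one_mul, Real.cos_add]
      push_cast
      ring
    have hsq : (Real.cos θ : ℂ) ^ 2 = 1 - (Real.sin θ : ℂ) ^ 2 := by
      rw [← Complex.ofReal_pow, Real.cos_sq']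
      push_cast
      ring
    rw [pow_succ', ih, hs, hc, mul_add, Matrix.mul_smul, Matrix.mul_smul, mul_sub, hM,
      Matrix.mul_smul, mul_one]
    have e1 : (Real.sin (n * θ) * Real.cos θ + Real.cos (n * θ) * Real.sin θ : ℂ) / Real.sin θ =
        Real.sin (n * θ) / Real.sin θ * Real.cos θ + Real.cos (n * θ) := by
      field_simp
    have e2 : (Real.cos (n * θ) * Real.cos θ - Real.sin (n * θ) * Real.sin θ : ℂ) =
        Real.cos (n * θ) * Real.cos θ + Real.sin (n * θ) / Real.sin θ * (Real.cos θ) ^ 2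
          - Real.sin (n * θ) / Real.sin θ := by
      rw [hsq]
      field_simp
      ring
    rw [e1, e2]
    module

/-- The quasi-energy of the normalised walk. -/
def quasiEnergy (r ξ : ℝ) : ℝ := Real.arccos (r * Real.cos ξ)

/-- The coin with real diagonal `r` and determinant one. -/
def normalCoin (r : ℝ) (b : ℂ) : Matrix (Fin 2) (Fin 2) ℂ := !![(r : ℂ), b; -conj b, (r : ℂ)]

/-- The off-diagonal phase of the symbol. -/
def offDiag (j : WalkType) (b : ℂ) (ξ : ℝ) : ℂ :=
  match j with
  | .A => b * Complex.exp (-(ξ * Complex.I))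
  | .G => b * Complex.exp (ξ * Complex.I)

/-- Both walk types give the same shape; the type enters only through the phase of the off-diagonal
entry. -/
lemma symbol_normalCoin (j : WalkType) (r : ℝ) (b : ℂ) (ξ : ℝ) :
    symbol j (normalCoin r b) ξ = !![r * Complex.exp (-(ξ * Complex.I)), offDiag j b ξ;
      -conj (offDiag j b ξ), r * Complex.exp (ξ * Complex.I)] := by
  cases j <;> ext i k <;> fin_cases i <;> fin_cases k <;>
    simp [symbol, normalCoin, leftMatrix, rightMatrix, offDiag, ← Complex.exp_conj] <;> ring

section

variable {r : ℝ} {b : ℂ} (j : WalkType) (φ : Fin 2 → ℂ)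

lemma continuous_offDiag (b : ℂ) : Continuous (offDiag j b) := by
  cases j <;> (unfold offDiag; fun_prop)

lemma conj_offDiag_mul_self (hb : r ^ 2 + ‖b‖ ^ 2 = 1) (ξ : ℝ) :
    conj (offDiag j b ξ) * offDiag j b ξ = 1 - (r : ℂ) ^ 2 := by
  have h : ‖offDiag j b ξ‖ = ‖b‖ := by
    cases j <;> simp [offDiag, Complex.norm_exp]
  rw [Complex.conj_mul', h, ← Complex.ofReal_one, ← hb]
  push_cast
  ring

lemma sin_quasiEnergy (r ξ : ℝ) : Real.sin (quasiEnergy r ξ) = √(1 - r ^ 2 * Real.cos ξ ^ 2) := by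
  rw [quasiEnergy, Real.sin_arccos, mul_pow]

/-- The spectral gap: `r cos ξ` avoids `±1`, so `arccos` is differentiable there and `sin θ` never
vanishes. -/
lemma abs_mul_cos_lt_one (hr : 0 < r) (hr1 : r < 1) (ξ : ℝ) : |r * Real.cos ξ| < 1 := by
  rw [← sq_lt_one_iff_abs_lt_one, mul_pow]
  linarith [one_sub_sq_mul_cos_sq_pos hr hr1 ξ]

lemma cos_quasiEnergy (hr : 0 < r) (hr1 : r < 1) (ξ : ℝ) :
    Real.cos (quasiEnergy r ξ) = r * Real.cos ξ := by
  have h := abs_lt.1 (abs_mul_cos_lt_one hr hr1 ξ)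
  exact Real.cos_arccos h.1.le h.2.le

lemma sin_quasiEnergy_pos (hr : 0 < r) (hr1 : r < 1) (ξ : ℝ) : 0 < Real.sin (quasiEnergy r ξ) := by
  rw [sin_quasiEnergy]
  exact Real.sqrt_pos.2 (one_sub_sq_mul_cos_sq_pos hr hr1 ξ)

lemma sq_sin_quasiEnergy (hr : 0 < r) (hr1 : r < 1) (ξ : ℝ) :
    Real.sin (quasiEnergy r ξ) ^ 2 = 1 - r ^ 2 * Real.cos ξ ^ 2 := by
  rw [sin_quasiEnergy, Real.sq_sqrt (one_sub_sq_mul_cos_sq_pos hr hr1 ξ).le]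

lemma hasDerivAt_quasiEnergy (hr : 0 < r) (hr1 : r < 1) (ξ : ℝ) :
    HasDerivAt (quasiEnergy r) (groupVelocity r ξ) ξ := by
  have h := abs_lt.1 (abs_mul_cos_lt_one hr hr1 ξ)
  refine ((Real.hasDerivAt_arccos h.1.ne' h.2.ne).comp ξ
    ((Real.hasDerivAt_cos ξ).const_mul r)).congr_deriv ?_
  rw [groupVelocity, mul_pow]
  ring

lemma continuous_sin_quasiEnergy (r : ℝ) : Continuous fun ξ => Real.sin (quasiEnergy r ξ) := by
  simp only [sin_quasiEnergy]
  fun_prop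

/-- The generator of the rotation performed by the symbol, applied to the initial state. -/
def rotated (r : ℝ) (b : ℂ) (ξ : ℝ) (i : Fin 2) : ℂ :=
  (![-(Complex.I * (r * Real.sin ξ : ℝ) * φ 0) + offDiag j b ξ * φ 1,
    -(conj (offDiag j b ξ) * φ 0) + Complex.I * (r * Real.sin ξ : ℝ) * φ 1] i) /
      (Real.sin (quasiEnergy r ξ) : ℂ)

lemma continuous_rotated (hr : 0 < r) (hr1 : r < 1) (i : Fin 2) :
    Continuous fun ξ => rotated j φ r b ξ i := by
  have h1 := continuous_offDiag j b
  have h2 := continuous_sin_quasiEnergy r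
  unfold rotated
  refine Continuous.div ?_ (by fun_prop) fun ξ =>
    Complex.ofReal_ne_zero.2 (sin_quasiEnergy_pos hr hr1 ξ).ne'
  fin_cases i
  · simp only [Fin.zero_eta, Matrix.cons_val_zero]
    fun_prop
  · simp only [Fin.mk_one, Matrix.cons_val_one]
    have := Complex.continuous_conj.comp h1
    fun_prop

/-- Cayley–Hamilton with trace `2 r cos ξ = 2 cos θ` and determinant `r² + |b|² = 1` puts the symbol
in the scope of `pow_eq_of_mul_self_eq`. -/
lemma symbol_pow_mulVec_normalCoin (hr : 0 < r) (hr1 : r < 1) (hb : r ^ 2 + ‖b‖ ^ 2 = 1)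
    (n : ℕ) (ξ : ℝ) (i : Fin 2) :
    (symbol j (normalCoin r b) ξ ^ n *ᵥ φ) i =
      (Real.cos (n * quasiEnergy r ξ) : ℂ) * φ i +
        (Real.sin (n * quasiEnergy r ξ) : ℂ) * rotated j φ r b ξ i := by
  have hs := (sin_quasiEnergy_pos hr hr1 ξ).ne'
  have hq := conj_offDiag_mul_self j hb ξ
  have hcos := cos_quasiEnergy hr hr1 ξ
  have e1 : Complex.exp (ξ * Complex.I) = Real.cos ξ + Real.sin ξ * Complex.I := by
    rw [Complex.exp_mul_I]; push_cast; ring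
  have e2 : Complex.exp (-(ξ * Complex.I)) = Real.cos ξ - Real.sin ξ * Complex.I := by
    rw [← neg_mul, Complex.exp_mul_I]; simp; ring
  have hsc : (Real.sin ξ : ℂ) ^ 2 + (Real.cos ξ : ℂ) ^ 2 = 1 := by
    exact_mod_cast Real.sin_sq_add_cos_sq ξ
  have hI := Complex.I_sq
  have hM : symbol j (normalCoin r b) ξ * symbol j (normalCoin r b) ξ =
      (2 * Real.cos (quasiEnergy r ξ) : ℂ) • symbol j (normalCoin r b) ξ - 1 := by
    rw [symbol_normalCoin, hcos, e1, e2]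
    ext i k
    fin_cases i <;> fin_cases k <;>
      simp only [Matrix.mul_apply, Fin.sum_univ_two, Matrix.sub_apply, Matrix.smul_apply,
        Fin.zero_eta, Fin.mk_one, Fin.isValue, Matrix.of_apply, Matrix.cons_val',
        Matrix.cons_val_zero, Matrix.cons_val_one, Matrix.cons_val_fin_one, smul_eq_mul,
        Matrix.one_apply_eq, Matrix.one_apply_ne, ne_eq, zero_ne_one, one_ne_zero,
        not_false_eq_true, Complex.ofReal_mul]
    · linear_combination -hq - (r : ℂ) ^ 2 * hsc + (r : ℂ) ^ 2 * (Real.sin ξ : ℂ) ^ 2 * hI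
    · ring
    · ring
    · linear_combination -hq - (r : ℂ) ^ 2 * hsc + (r : ℂ) ^ 2 * (Real.sin ξ : ℂ) ^ 2 * hI
  rw [pow_eq_of_mul_self_eq hs hM, symbol_normalCoin, hcos, e1, e2]
  fin_cases i <;>
    simp [rotated, Matrix.mulVec, dotProduct, Fin.sum_univ_two] <;> ring

/-- The expectation of the generator in the initial state. -/
def energyMean (r : ℝ) (b : ℂ) (ξ : ℝ) : ℝ :=
  (-(r * Real.sin ξ * (‖φ 0‖ ^ 2 - ‖φ 1‖ ^ 2)) +
    2 * (offDiag j b ξ * conj (φ 0) * φ 1).im) / Real.sin (quasiEnergy r ξ)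

/-- The generator is anti-Hermitian, so its expectation is purely imaginary. -/
lemma conj_mul_rotated (ξ : ℝ) :
    conj (φ 0) * rotated j φ r b ξ 0 + conj (φ 1) * rotated j φ r b ξ 1 =
      Complex.I * energyMean j φ r b ξ := by
  have h0 := Complex.conj_mul' (φ 0)
  have h1 := Complex.conj_mul' (φ 1)
  have h2 : offDiag j b ξ * conj (φ 0) * φ 1 - conj (offDiag j b ξ) * φ 0 * conj (φ 1) =
      Complex.I * (2 * (offDiag j b ξ * conj (φ 0) * φ 1).im : ℝ) := by
    have := Complex.sub_conj (offDiag j b ξ * conj (φ 0) * φ 1)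
    simp only [map_mul, Complex.conj_conj] at this
    rw [this, mul_comm]
  simp only [rotated, energyMean, Matrix.cons_val_zero, Matrix.cons_val_one]
  push_cast at h2 ⊢
  rw [mul_div_assoc', mul_div_assoc', mul_div_assoc', ← add_div]
  congr 1
  linear_combination h2 - Complex.I * r * Complex.sin ξ * (h0 - h1)

/-- The generator is anti-Hermitian with square `-1`, hence unitary, and preserves the norm of `φ`.
-/
lemma conj_rotated_mul_rotated (hr : 0 < r) (hr1 : r < 1) (hb : r ^ 2 + ‖b‖ ^ 2 = 1)
    (hφ : ‖φ 0‖ ^ 2 + ‖φ 1‖ ^ 2 = 1) (ξ : ℝ) :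
    conj (rotated j φ r b ξ 0) * rotated j φ r b ξ 0 +
      conj (rotated j φ r b ξ 1) * rotated j φ r b ξ 1 = 1 := by
  have h0 := Complex.conj_mul' (φ 0)
  have h1 := Complex.conj_mul' (φ 1)
  have hφ' : (‖φ 0‖ : ℂ) ^ 2 + (‖φ 1‖ : ℂ) ^ 2 = 1 := by exact_mod_cast hφ
  have hq := conj_offDiag_mul_self j hb ξ
  have hsc : (Complex.sin ξ) ^ 2 + (Complex.cos ξ) ^ 2 = 1 := Complex.sin_sq_add_cos_sq ξ
  have hs : (Real.sin (quasiEnergy r ξ) : ℂ) ^ 2 = 1 - (r : ℂ) ^ 2 * (Complex.cos ξ) ^ 2 := by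
    exact_mod_cast sq_sin_quasiEnergy hr hr1 ξ
  have hs0 : (Real.sin (quasiEnergy r ξ) : ℂ) ≠ 0 :=
    Complex.ofReal_ne_zero.2 (sin_quasiEnergy_pos hr hr1 ξ).ne'
  simp only [rotated, Matrix.cons_val_zero, Matrix.cons_val_one, map_div₀, map_add, map_neg,
    map_mul, Complex.conj_ofReal, Complex.conj_I, Complex.conj_conj]
  rw [div_mul_div_comm, div_mul_div_comm, ← add_div, ← sq, hs, div_eq_one_iff_eq (by
    rw [← hs]; exact pow_ne_zero 2 hs0)]
  push_cast
  have hI := Complex.I_sq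
  linear_combination
    ((r : ℂ) ^ 2 * Complex.sin ξ ^ 2 + (1 - (r : ℂ) ^ 2)) * (h0 + h1 + hφ')
    + (conj (φ 0) * φ 0 + conj (φ 1) * φ 1) * (hq - (r : ℂ) ^ 2 * Complex.sin ξ ^ 2 * hI)
    + (r : ℂ) ^ 2 * hsc

end

/-! ### The limit of the characteristic functions -/

section

variable {r : ℝ} {b : ℂ} (j : WalkType) (φ : Fin 2 → ℂ)

lemma tendsto_nat_mul_quasiEnergy_sub (hr : 0 < r) (hr1 : r < 1) (ξ t : ℝ) :
    Tendsto (fun n : ℕ => (n : ℝ) * (quasiEnergy r (ξ + t / n) - quasiEnergy r ξ)) atTop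
      (𝓝 (t * groupVelocity r ξ)) := by
  -- Differentiating in `u = 1/n` rather than in `t/n` covers `t = 0` as well.
  have hd : HasDerivAt (fun u : ℝ => quasiEnergy r (ξ + t * u)) (groupVelocity r ξ * t) 0 := by
    have h1 : HasDerivAt (fun u : ℝ => ξ + t * u) t 0 := by
      simpa using ((hasDerivAt_id (0 : ℝ)).const_mul t).const_add ξ
    refine HasDerivAt.comp (0 : ℝ) (h₂ := quasiEnergy r) ?_ h1
    simpa using hasDerivAt_quasiEnergy hr hr1 ξ
  have hu : Tendsto (fun n : ℕ => (n : ℝ)⁻¹) atTop (𝓝[>] 0) :=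
    tendsto_inv_atTop_nhdsGT_zero.comp tendsto_natCast_atTop_atTop
  rw [mul_comm t]
  refine (hd.tendsto_slope_zero_right.comp hu).congr fun n => ?_
  simp [div_eq_mul_inv]

/-- The integrand in the Fourier representation of the characteristic function of `Xₙ / n`. -/
def charIntegrand (r : ℝ) (b : ℂ) (t : ℝ) (n : ℕ) (ξ : ℝ) : ℂ :=
  conj ((symbol j (normalCoin r b) ξ ^ n *ᵥ φ) 0) *
      (symbol j (normalCoin r b) (ξ + t / n) ^ n *ᵥ φ) 0 +
    conj ((symbol j (normalCoin r b) ξ ^ n *ᵥ φ) 1) *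
      (symbol j (normalCoin r b) (ξ + t / n) ^ n *ᵥ φ) 1

/-- With `δ = n(θ(ξ + t/n) - θ(ξ))`, the integrand is exactly `cos δ + i e(ξ) sin δ` plus two
errors: bounded oscillating factors times the pairings of `W(ξ + t/n) - W(ξ)` with `φ` and with
`W(ξ)`. Continuity of `W` kills the errors. -/
lemma tendsto_charIntegrand (hr : 0 < r) (hr1 : r < 1) (hb : r ^ 2 + ‖b‖ ^ 2 = 1)
    (hφ : ‖φ 0‖ ^ 2 + ‖φ 1‖ ^ 2 = 1) (t ξ : ℝ) :
    Tendsto (fun n => charIntegrand j φ r b t n ξ) atTop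
      (𝓝 (Real.cos (t * groupVelocity r ξ) +
        Complex.I * (energyMean j φ r b ξ * Real.sin (t * groupVelocity r ξ) : ℝ))) := by
  set W := rotated j φ r b with hW
  have hshift : Tendsto (fun n : ℕ => ξ + t / n) atTop (𝓝 ξ) := by
    simpa using (tendsto_const_div_atTop_nhds_zero_nat t).const_add ξ
  have hWt : ∀ i, Tendsto (fun n : ℕ => W (ξ + t / n) i) atTop (𝓝 (W ξ i)) := fun i =>
    ((continuous_rotated j φ hr hr1 i).tendsto ξ).comp hshift
  have hB : Tendsto (fun n : ℕ => conj (φ 0) * (W (ξ + t / n) 0 - W ξ 0) +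
      conj (φ 1) * (W (ξ + t / n) 1 - W ξ 1)) atTop (𝓝 0) := by
    simpa using (((hWt 0).sub_const (W ξ 0)).const_mul (conj (φ 0))).add
      (((hWt 1).sub_const (W ξ 1)).const_mul (conj (φ 1)))
  have hD : Tendsto (fun n : ℕ => conj (W ξ 0) * (W (ξ + t / n) 0 - W ξ 0) +
      conj (W ξ 1) * (W (ξ + t / n) 1 - W ξ 1)) atTop (𝓝 0) := by
    simpa using (((hWt 0).sub_const (W ξ 0)).const_mul (conj (W ξ 0))).add
      (((hWt 1).sub_const (W ξ 1)).const_mul (conj (W ξ 1)))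
  have hbdd : ∀ (x y : ℕ → ℝ) (z : ℕ → ℂ), (∀ n, |x n| ≤ 1) → (∀ n, |y n| ≤ 1) →
      Tendsto z atTop (𝓝 0) → Tendsto (fun n => (x n : ℂ) * y n * z n) atTop (𝓝 0) := by
    intro x y z hx hy hz
    refine squeeze_zero_norm (fun n => ?_) (tendsto_zero_iff_norm_tendsto_zero.1 hz)
    rw [norm_mul, norm_mul, Complex.norm_real, Complex.norm_real, Real.norm_eq_abs,
      Real.norm_eq_abs]
    have : |x n| * |y n| ≤ 1 := mul_le_one₀ (hx n) (abs_nonneg _) (hy n)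
    exact mul_le_of_le_one_left (norm_nonneg _) this
  have hδ := tendsto_nat_mul_quasiEnergy_sub hr hr1 ξ t
  have hmain : Tendsto (fun n : ℕ =>
      (Real.cos ((n : ℝ) * (quasiEnergy r (ξ + t / n) - quasiEnergy r ξ)) : ℂ) +
        Complex.I * (energyMean j φ r b ξ *
          Real.sin ((n : ℝ) * (quasiEnergy r (ξ + t / n) - quasiEnergy r ξ)) : ℝ)) atTop
      (𝓝 (Real.cos (t * groupVelocity r ξ) +
        Complex.I * (energyMean j φ r b ξ * Real.sin (t * groupVelocity r ξ) : ℝ))) := by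
    have hcont : Continuous fun x : ℝ => (Real.cos x : ℂ) +
        Complex.I * (energyMean j φ r b ξ * Real.sin x : ℝ) := by fun_prop
    exact (hcont.tendsto _).comp hδ
  have h1 := hbdd (fun n => Real.cos (n * quasiEnergy r ξ))
    (fun n => Real.sin (n * quasiEnergy r (ξ + t / n))) _
    (fun n => Real.abs_cos_le_one _) (fun n => Real.abs_sin_le_one _) hB
  have h2 := hbdd (fun n => Real.sin (n * quasiEnergy r ξ))
    (fun n => Real.sin (n * quasiEnergy r (ξ + t / n))) _
    (fun n => Real.abs_sin_le_one _) (fun n => Real.abs_sin_le_one _) hD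
  have hsum := (hmain.add h1).add h2
  rw [add_zero, add_zero] at hsum
  refine hsum.congr fun n => ?_
  have k1 := conj_mul_rotated (r := r) (b := b) j φ ξ
  have k2 := conj_rotated_mul_rotated j φ hr hr1 hb hφ ξ
  have k3 : conj (W ξ 0) * φ 0 + conj (W ξ 1) * φ 1 = -(Complex.I * energyMean j φ r b ξ) := by
    have := congrArg conj k1
    simp only [map_add, map_mul, Complex.conj_conj, Complex.conj_I, Complex.conj_ofReal] at this
    rw [hW]
    linear_combination this
  have k0 : conj (φ 0) * φ 0 + conj (φ 1) * φ 1 = 1 := by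
    rw [Complex.conj_mul', Complex.conj_mul']
    exact_mod_cast hφ
  rw [← hW] at k1 k2
  rw [charIntegrand, mul_sub, Real.cos_sub, Real.sin_sub]
  simp only [symbol_pow_mulVec_normalCoin j φ hr hr1 hb, ← hW, map_add, map_mul,
    Complex.conj_ofReal]
  generalize Real.cos (n * quasiEnergy r ξ) = c
  generalize Real.sin (n * quasiEnergy r ξ) = s
  generalize Real.cos (n * quasiEnergy r (ξ + t / n)) = c'
  generalize Real.sin (n * quasiEnergy r (ξ + t / n)) = s'
  push_cast
  linear_combination (-(c * c' : ℂ)) * k0 - (c * s' : ℂ) * k1 - (s * c' : ℂ) * k3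
    - (s * s' : ℂ) * k2

lemma norm_charIntegrand_le (hr : 0 < r) (hr1 : r < 1) (hb : r ^ 2 + ‖b‖ ^ 2 = 1)
    (hφ : ‖φ 0‖ ^ 2 + ‖φ 1‖ ^ 2 = 1) (t ξ : ℝ) (n : ℕ) :
    ‖charIntegrand j φ r b t n ξ‖ ≤ 8 := by
  -- Crude bound `|cos| |φᵢ| + |sin| |Wᵢ| ≤ 2` per component; two components of two factors each
  -- give 8. Only uniformity in `n` and `ξ` matters.
  have key : ∀ ζ i, ‖(symbol j (normalCoin r b) ζ ^ n *ᵥ φ) i‖ ≤ 2 := by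
    intro ζ i
    have hφi : ‖φ i‖ ≤ 1 := by
      fin_cases i <;>
        simp only [Fin.zero_eta, Fin.mk_one] <;> nlinarith [sq_nonneg ‖φ 0‖, sq_nonneg ‖φ 1‖]
    have hW : ‖rotated j φ r b ζ 0‖ ^ 2 + ‖rotated j φ r b ζ 1‖ ^ 2 = 1 := by
      have := conj_rotated_mul_rotated j φ hr hr1 hb hφ ζ
      rw [Complex.conj_mul', Complex.conj_mul'] at this
      exact_mod_cast this
    have hWi : ‖rotated j φ r b ζ i‖ ≤ 1 := by
      fin_cases i <;> simp only [Fin.zero_eta, Fin.mk_one] <;>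
        nlinarith [sq_nonneg ‖rotated j φ r b ζ 0‖, sq_nonneg ‖rotated j φ r b ζ 1‖]
    rw [symbol_pow_mulVec_normalCoin j φ hr hr1 hb]
    refine (norm_add_le _ _).trans ?_
    rw [norm_mul, norm_mul, Complex.norm_real, Complex.norm_real, Real.norm_eq_abs,
      Real.norm_eq_abs]
    have h1 := mul_le_one₀ (Real.abs_cos_le_one (n * quasiEnergy r ζ)) (norm_nonneg (φ i)) hφi
    have h2 := mul_le_one₀ (Real.abs_sin_le_one (n * quasiEnergy r ζ))
      (norm_nonneg (rotated j φ r b ζ i)) hWi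
    linarith
  refine (norm_add_le _ _).trans ?_
  rw [norm_mul, norm_mul, RCLike.norm_conj, RCLike.norm_conj]
  have h : ∀ i, ‖(symbol j (normalCoin r b) ξ ^ n *ᵥ φ) i‖ *
      ‖(symbol j (normalCoin r b) (ξ + t / n) ^ n *ᵥ φ) i‖ ≤ 2 * 2 := fun i =>
    mul_le_mul (key _ i) (key _ i) (norm_nonneg _) zero_le_two
  linarith [h 0, h 1]

lemma continuous_charIntegrand (t : ℝ) (n : ℕ) : Continuous (charIntegrand j φ r b t n) := by
  unfold charIntegrand
  simp only [symbol_pow_mulVec]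
  fun_prop

lemma tendsto_integral_charIntegrand (hr : 0 < r) (hr1 : r < 1) (hb : r ^ 2 + ‖b‖ ^ 2 = 1)
    (hφ : ‖φ 0‖ ^ 2 + ‖φ 1‖ ^ 2 = 1) (t x y : ℝ) :
    Tendsto (fun n => ∫ ξ in x..y, charIntegrand j φ r b t n ξ) atTop
      (𝓝 (∫ ξ in x..y, (Real.cos (t * groupVelocity r ξ) +
        Complex.I * (energyMean j φ r b ξ * Real.sin (t * groupVelocity r ξ) : ℝ) : ℂ))) := by
  refine intervalIntegral.tendsto_integral_filter_of_dominated_convergence (fun _ => 8)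
    (Eventually.of_forall fun n => (continuous_charIntegrand j φ t n).aestronglyMeasurable)
    (Eventually.of_forall fun n => ae_of_all _ fun ξ _ =>
      norm_charIntegrand_le j φ hr hr1 hb hφ t ξ n)
    intervalIntegrable_const (ae_of_all _ fun ξ _ => tendsto_charIntegrand j φ hr hr1 hb hφ t ξ)

/-- The part of `energyMean` that is not proportional to the group velocity is antisymmetric about
`π / 2`. -/
lemma exists_energyMean_eq (hr : 0 < r) (b : ℂ) : ∃ C : ℝ, ∀ ξ, energyMean j φ r b ξ =
    -(asymmetry j (normalCoin r b) φ * groupVelocity r ξ) +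
      C * Real.cos ξ / Real.sin (quasiEnergy r ξ) := by
  -- Expand `e^{∓iξ}` in the off-diagonal term: the cosine carries this imaginary part, while the
  -- sine carries the real part, which is `Theta` up to a factor.
  refine ⟨2 * (b * conj (φ 0) * φ 1).im, fun ξ => ?_⟩
  have e1 : Complex.exp (ξ * Complex.I) = Real.cos ξ + Real.sin ξ * Complex.I := by
    rw [Complex.exp_mul_I]; push_cast; ring
  have e2 : Complex.exp (-(ξ * Complex.I)) = Real.cos ξ - Real.sin ξ * Complex.I := by
    rw [← neg_mul, Complex.exp_mul_I]; simp; ring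
  rw [energyMean, groupVelocity, ← sin_quasiEnergy, mul_div_assoc', ← neg_div, ← add_div]
  congr 1
  cases j
  · simp only [asymmetry, Theta, normalCoin, offDiag, e2, Matrix.of_apply, Matrix.cons_val',
      Matrix.cons_val_zero, Matrix.cons_val_one, Matrix.cons_val_fin_one, Complex.norm_real,
      Real.norm_eq_abs, sq_abs]
    simp only [Complex.add_re, Complex.mul_re, Complex.mul_im, Complex.conj_re, Complex.conj_im,
      Complex.ofReal_re, Complex.ofReal_im, Complex.I_re, Complex.I_im, Complex.sub_re,
      Complex.sub_im]
    field_simp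
    ring
  · simp only [asymmetry, Theta, normalCoin, offDiag, e1, Matrix.of_apply, Matrix.cons_val',
      Matrix.cons_val_zero, Matrix.cons_val_one, Matrix.cons_val_fin_one, Complex.norm_real,
      Real.norm_eq_abs, sq_abs]
    simp only [Complex.add_re, Complex.add_im, Complex.mul_re, Complex.mul_im, Complex.conj_re,
      Complex.conj_im, Complex.ofReal_re, Complex.ofReal_im, Complex.I_re, Complex.I_im,
      Complex.neg_re, Complex.neg_im]
    field_simp
    ring

lemma continuous_energyMean (hr : 0 < r) (hr1 : r < 1) : Continuous (energyMean j φ r b) := by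
  have h1 := continuous_offDiag j b
  have h2 := continuous_sin_quasiEnergy r
  exact Continuous.div (by fun_prop) h2 fun ξ => (sin_quasiEnergy_pos hr hr1 ξ).ne'

/-- The reflection `ξ ↦ π - ξ` exchanges the two halves of the period, fixes `v` and `sin θ` and
reverses `cos ξ`, so the term with the constant `C` cancels. -/
lemma integral_limit_charIntegrand (hr : 0 < r) (hr1 : r < 1) (t : ℝ) :
    ∫ ξ in (-(Real.pi / 2))..(-(Real.pi / 2) + 2 * Real.pi),
        (Real.cos (t * groupVelocity r ξ) +
          Complex.I * (energyMean j φ r b ξ * Real.sin (t * groupVelocity r ξ) : ℝ) : ℂ) =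
      2 * ∫ ξ in (-(Real.pi / 2))..(Real.pi / 2),
        ((Real.cos (t * groupVelocity r ξ) : ℂ) - Complex.I *
          (asymmetry j (normalCoin r b) φ * groupVelocity r ξ *
            Real.sin (t * groupVelocity r ξ) : ℝ)) := by
  have hv := continuous_groupVelocity hr hr1
  have he := continuous_energyMean (b := b) j φ hr hr1
  set F : ℝ → ℂ := fun ξ => (Real.cos (t * groupVelocity r ξ) +
          Complex.I * (energyMean j φ r b ξ * Real.sin (t * groupVelocity r ξ) : ℝ) : ℂ) with hF
  have hFc : Continuous F := by fun_prop
  have hFc' : Continuous fun ξ => F (Real.pi - ξ) := hFc.comp (continuous_sub_left _)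
  have hrefl := intervalIntegral.integral_comp_sub_left (a := -(Real.pi / 2)) (b := Real.pi / 2)
    F Real.pi
  have hends : Real.pi - -(Real.pi / 2) = -(Real.pi / 2) + 2 * Real.pi := by ring
  rw [hends, sub_half] at hrefl
  rw [← intervalIntegral.integral_add_adjacent_intervals (hFc.intervalIntegrable _ (Real.pi / 2))
    (hFc.intervalIntegrable _ _), ← hrefl, ← intervalIntegral.integral_add
    (hFc.intervalIntegrable _ _)
    (hFc'.intervalIntegrable _ _),
    ← intervalIntegral.integral_const_mul]
  refine intervalIntegral.integral_congr fun ξ _ => ?_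
  obtain ⟨C, hC⟩ := exists_energyMean_eq j φ hr b
  have hs : Real.sin (quasiEnergy r (Real.pi - ξ)) = Real.sin (quasiEnergy r ξ) := by
    simp [sin_quasiEnergy]
  simp only [hF, hC, groupVelocity_pi_sub, Real.cos_pi_sub, hs]
  push_cast
  ring

/-- Cauchy–Schwarz for the unit vectors `(r, |b|)` and `(|α|² - |β|², 2|α||β|)`. This makes the
limit density nonnegative. -/
lemma abs_mul_asymmetry_normalCoin_le (hr : 0 < r) (hb : r ^ 2 + ‖b‖ ^ 2 = 1)
    (hφ : ‖φ 0‖ ^ 2 + ‖φ 1‖ ^ 2 = 1) : |r * asymmetry j (normalCoin r b) φ| ≤ 1 := by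
  have hre : ∃ σ : ℝ, |σ| = 1 ∧ r * asymmetry j (normalCoin r b) φ =
      r * (‖φ 0‖ ^ 2 - ‖φ 1‖ ^ 2) + 2 * (σ * (b * conj (φ 0) * φ 1).re) := by
    cases j
    · refine ⟨1, by norm_num, ?_⟩
      simp only [asymmetry, Theta, normalCoin, Matrix.of_apply, Matrix.cons_val',
        Matrix.cons_val_zero, Matrix.cons_val_one, Matrix.cons_val_fin_one, Complex.norm_real,
        Real.norm_eq_abs, sq_abs, Complex.add_re, Complex.mul_re, Complex.mul_im, Complex.conj_re,
        Complex.conj_im, Complex.ofReal_re, Complex.ofReal_im]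
      field_simp
      ring
    · refine ⟨-1, by norm_num, ?_⟩
      simp only [asymmetry, Theta, normalCoin, Matrix.of_apply, Matrix.cons_val',
        Matrix.cons_val_zero, Matrix.cons_val_one, Matrix.cons_val_fin_one, Complex.norm_real,
        Real.norm_eq_abs, sq_abs, Complex.add_re, Complex.mul_re, Complex.mul_im, Complex.conj_re,
        Complex.conj_im, Complex.ofReal_re, Complex.ofReal_im, Complex.neg_re, Complex.neg_im]
      field_simp
      ring
  obtain ⟨σ, hσ, e⟩ := hre
  have hX : |σ * (b * conj (φ 0) * φ 1).re| ≤ ‖b‖ * (‖φ 0‖ * ‖φ 1‖) := by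
    rw [abs_mul, hσ, one_mul]
    refine (Complex.abs_re_le_norm _).trans_eq ?_
    rw [norm_mul, norm_mul, RCLike.norm_conj, mul_assoc]
  have hone : (r ^ 2 + ‖b‖ ^ 2) *
      ((‖φ 0‖ ^ 2 - ‖φ 1‖ ^ 2) ^ 2 + 4 * (‖φ 0‖ * ‖φ 1‖) ^ 2) = 1 := by
    have : (‖φ 0‖ ^ 2 - ‖φ 1‖ ^ 2) ^ 2 + 4 * (‖φ 0‖ * ‖φ 1‖) ^ 2 =
        (‖φ 0‖ ^ 2 + ‖φ 1‖ ^ 2) ^ 2 := by ring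
    rw [this, hb, hφ]
    norm_num
  rw [e]
  generalize σ * (b * conj (φ 0) * φ 1).re = X at hX
  generalize ‖φ 0‖ ^ 2 - ‖φ 1‖ ^ 2 = D at hone ⊢
  generalize ‖φ 0‖ * ‖φ 1‖ = m at hX hone
  -- Lagrange's identity: `(rD + 2|b|m)² + (2rm - |b|D)² = (r² + |b|²)(D² + 4m²) = 1`.
  have h1 : |r * D + 2 * (‖b‖ * m)| ≤ 1 := by
    rw [← sq_le_one_iff_abs_le_one]
    nlinarith [sq_nonneg (2 * r * m - ‖b‖ * D)]
  have h2 : |r * D - 2 * (‖b‖ * m)| ≤ 1 := by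
    rw [← sq_le_one_iff_abs_le_one]
    nlinarith [sq_nonneg (2 * r * m + ‖b‖ * D)]
  rw [abs_le] at h1 h2 hX ⊢
  constructor <;> linarith [h1.1, h1.2, h2.1, h2.2, hX.1, hX.2]

end

/-! ### Normalisation of the coin and conclusion -/

lemma unitary_fin_two (U : Matrix.unitaryGroup (Fin 2) ℂ) :
    ‖U 0 0‖ ^ 2 + ‖U 0 1‖ ^ 2 = 1 ∧ ‖U 0 1‖ ^ 2 + ‖U 1 1‖ ^ 2 = 1 ∧
      conj (U 0 0) * U 1 0 = -(conj (U 0 1) * U 1 1) := by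
  have h1 : (U : Matrix (Fin 2) (Fin 2) ℂ) * star (U : Matrix (Fin 2) (Fin 2) ℂ) = 1 :=
    Matrix.mem_unitaryGroup_iff.1 U.2
  have h2 : star (U : Matrix (Fin 2) (Fin 2) ℂ) * (U : Matrix (Fin 2) (Fin 2) ℂ) = 1 :=
    Matrix.UnitaryGroup.star_mul_self U
  have e00 := congrFun (congrFun h1 0) 0
  have e10 := congrFun (congrFun h1 1) 0
  have e11 := congrFun (congrFun h2 1) 1
  simp only [Matrix.mul_apply, Matrix.star_apply, Fin.sum_univ_two, RCLike.star_def,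
    Matrix.one_apply_eq, Complex.mul_conj', Complex.conj_mul'] at e00 e11
  simp only [Matrix.mul_apply, Matrix.star_apply, Fin.sum_univ_two, RCLike.star_def,
    Matrix.one_apply_ne (one_ne_zero : (1 : Fin 2) ≠ 0)] at e10
  refine ⟨by exact_mod_cast e00, by exact_mod_cast e11, ?_⟩
  linear_combination e10

/-- Up to phases on its two halves, every coin with non-zero diagonal is normalised. -/
lemma exists_normalCoin (j : WalkType) (U : Matrix (Fin 2) (Fin 2) ℂ) (ha : U 0 0 ≠ 0)
    (had : ‖U 1 1‖ = ‖U 0 0‖) (h : conj (U 0 0) * U 1 0 = -(conj (U 0 1) * U 1 1)) :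
    ∃ l m b : ℂ, ‖l‖ = 1 ∧ ‖m‖ = 1 ∧ ‖b‖ = ‖U 0 1‖ ∧
      leftMatrix j U = l • leftMatrix j (normalCoin ‖U 0 0‖ b) ∧
      rightMatrix j U = m • rightMatrix j (normalCoin ‖U 0 0‖ b) ∧
      ∀ φ, asymmetry j U φ = asymmetry j (normalCoin ‖U 0 0‖ b) φ := by
  obtain ⟨r, hr⟩ : ∃ r : ℝ, ‖U 0 0‖ = r := ⟨_, rfl⟩
  rw [hr] at had ⊢
  have hr0 : r ≠ 0 := by rw [← hr]; exact norm_ne_zero_iff.2 ha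
  have hrc : (r : ℂ) ≠ 0 := Complex.ofReal_ne_zero.2 hr0
  have hnr : ‖(r : ℂ)‖ = r := by rw [← hr]; simp
  obtain ⟨l, hl⟩ : ∃ l : ℂ, l = U 0 0 / r := ⟨_, rfl⟩
  obtain ⟨m, hm⟩ : ∃ m : ℂ, m = U 1 1 / r := ⟨_, rfl⟩
  have hl1 : ‖l‖ = 1 := by rw [hl, norm_div, hnr, hr, div_self hr0]
  have hm1 : ‖m‖ = 1 := by rw [hm, norm_div, hnr, had, div_self hr0]
  have hll : conj l * l = 1 := by rw [Complex.conj_mul', hl1]; simp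
  have hmm : conj m * m = 1 := by rw [Complex.conj_mul', hm1]; simp
  have e00 : U 0 0 = l * r := by rw [hl, div_mul_cancel₀ _ hrc]
  have e11 : U 1 1 = m * r := by rw [hm, div_mul_cancel₀ _ hrc]
  have e10 : U 1 0 = -(l * m * conj (U 0 1)) := by
    rw [e00, e11, map_mul, Complex.conj_ofReal] at h
    refine mul_left_cancel₀ hrc ?_
    linear_combination l * h - r * U 1 0 * hll
  -- The phases `l` of `a` and `m` of `d` multiply rows for the A-type and columns for the G-type,
  -- so `b` sheds `l` in the first case and `m` in the second.
  cases j
  · have e01 : U 0 1 = l * (conj l * U 0 1) := by linear_combination -U 0 1 * hll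
    refine ⟨l, m, conj l * U 0 1, hl1, hm1, by rw [norm_mul, RCLike.norm_conj, hl1, one_mul],
      ?_, ?_, fun φ => ?_⟩
    · ext i k
      fin_cases i <;> fin_cases k <;> simp [leftMatrix, normalCoin, e00, ← e01]
    · ext i k
      fin_cases i <;> fin_cases k <;> simp [rightMatrix, normalCoin, e10, e11]
      ring
    · simp only [asymmetry, Theta, hr]
      rw [e00]
      simp only [normalCoin, Matrix.of_apply, Matrix.cons_val', Matrix.cons_val_zero,
        Matrix.cons_val_one, Matrix.cons_val_fin_one, hnr]
      congr 3
      simp only [map_mul, Complex.conj_conj, Complex.conj_ofReal]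
      ring
  · have e01 : U 0 1 = m * (conj m * U 0 1) := by linear_combination -U 0 1 * hmm
    refine ⟨l, m, conj m * U 0 1, hl1, hm1, by rw [norm_mul, RCLike.norm_conj, hm1, one_mul],
      ?_, ?_, fun φ => ?_⟩
    · ext i k
      fin_cases i <;> fin_cases k <;> simp [leftMatrix, normalCoin, e10, e00]
      ring
    · ext i k
      fin_cases i <;> fin_cases k <;> simp [rightMatrix, normalCoin, e11, ← e01]
    · simp only [asymmetry, Theta, hr]
      rw [e10, e00]
      simp only [normalCoin, Matrix.of_apply, Matrix.cons_val', Matrix.cons_val_zero,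
        Matrix.cons_val_one, Matrix.cons_val_fin_one, hnr]
      congr 3
      simp only [map_mul, map_neg, Complex.conj_conj, Complex.conj_ofReal]
      linear_combination (-((r : ℂ) * φ 1 * conj m * U 0 1 * conj (φ 0)) -
        (r : ℂ) * conj (φ 1) * m * conj (U 0 1) * φ 0) * hll

/-! ### From amplitudes to random variables -/

lemma integral_walkPMF_exp (j : WalkType) (U : Matrix.unitaryGroup (Fin 2) ℂ) (φ : QubitState)
    (n : ℕ) (h : ℝ) :
    ∫ k : ℤ, Complex.exp (k * (h * Complex.I)) ∂(walkPMF j U φ n).toMeasure =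
      ∑ k ∈ Finset.Icc (-(n : ℤ)) n,
        (locationProb j U φ.1 n k : ℂ) * Complex.exp (k * (h * Complex.I)) := by
  have hint : Integrable (fun k : ℤ => Complex.exp (k * (h * Complex.I)))
      (walkPMF j U φ n).toMeasure := by
    refine Integrable.of_bound (C := 1) (by fun_prop) (ae_of_all _ fun k => ?_)
    rw [Complex.norm_exp]
    simp
  have hp : ∀ k, 0 ≤ locationProb j U φ.1 n k := fun k => by unfold locationProb; positivity
  have hw : ∀ k, ((walkPMF j U φ n) k).toReal = locationProb j U φ.1 n k := fun k =>
    ENNReal.toReal_ofReal (hp k)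
  rw [PMF.integral_eq_tsum _ _ hint]
  simp only [hw, Complex.real_smul]
  refine tsum_eq_sum fun k hk => ?_
  simp [locationProb, amplitude_eq_zero j _ φ.1 n k hk]

lemma charFun_map_div (j : WalkType) (U : Matrix.unitaryGroup (Fin 2) ℂ) (φ : QubitState) (n : ℕ)
    {Ω : Type*} [MeasurableSpace Ω] {P : Measure Ω} {X : Ω → ℤ}
    (hX : HasLaw X (walkPMF j U φ n).toMeasure P) (t : ℝ) :
    charFun (P.map fun ω => (X ω : ℝ) / (n : ℝ)) t =
      ∑ k ∈ Finset.Icc (-(n : ℤ)) n,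
        (locationProb j U φ.1 n k : ℂ) * Complex.exp (k * ((t / n : ℝ) * Complex.I)) := by
  have hXm := hX.aemeasurable
  have hm : Measurable fun k : ℤ => (k : ℝ) / (n : ℝ) := by fun_prop
  have hXd : AEMeasurable (fun ω => (X ω : ℝ) / (n : ℝ)) P := hm.comp_aemeasurable hXm
  rw [← integral_walkPMF_exp, ← hX.integral_comp (by fun_prop), charFun_apply_real,
    integral_map hXd (by fun_prop)]
  refine integral_congr_ae (ae_of_all _ fun ω => ?_)
  simp only [Function.comp_apply]
  congr 1
  push_cast
  ring

/-- Passing to the normal coin preserves `|a|`, the location probabilities and the asymmetry. The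
bound is included because it comes from the same normal coin. -/
lemma tendsto_charFun_walk (j : WalkType) (U : Matrix.unitaryGroup (Fin 2) ℂ) (φ : QubitState)
    (ha : U 0 0 ≠ 0) (hb : U 0 1 ≠ 0) (t : ℝ) :
    |‖U 0 0‖ * asymmetry j U φ.1| ≤ 1 ∧
    Tendsto (fun n : ℕ => ∑ k ∈ Finset.Icc (-(n : ℤ)) n,
        (locationProb j U φ.1 n k : ℂ) * Complex.exp (k * ((t / n : ℝ) * Complex.I))) atTop
      (𝓝 (charFun (arcLaw ‖U 0 0‖ (asymmetry j U φ.1)) t)) := by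
  obtain ⟨h1, h2, h3⟩ := unitary_fin_two U
  have had : ‖U 1 1‖ = ‖U 0 0‖ := by
    rw [← sq_eq_sq₀ (norm_nonneg _) (norm_nonneg _)]
    linarith
  obtain ⟨l, m, b, hl, hm, hbn, hL, hR, hκ⟩ := exists_normalCoin j U ha had h3
  have hr : 0 < ‖U 0 0‖ := norm_pos_iff.2 ha
  have hb0 : 0 < ‖U 0 1‖ := norm_pos_iff.2 hb
  have hr1 : ‖U 0 0‖ < 1 := by nlinarith
  have hone : ‖U 0 0‖ ^ 2 + ‖b‖ ^ 2 = 1 := by rw [hbn]; exact h1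
  have hκ1 := abs_mul_asymmetry_normalCoin_le j φ.1 hr hone φ.2
  rw [hκ]
  refine ⟨hκ1, ?_⟩
  have hpi : (2 * Real.pi : ℂ)⁻¹ * 2 = (Real.pi : ℂ)⁻¹ := by
    rw [mul_inv, mul_right_comm, inv_mul_cancel₀ two_ne_zero, one_mul]
  have hlim := (tendsto_integral_charIntegrand j φ.1 hr hr1 hone φ.2 t (-(Real.pi / 2))
    (-(Real.pi / 2) + 2 * Real.pi)).const_mul (2 * Real.pi : ℂ)⁻¹
  rw [integral_limit_charIntegrand j φ.1 hr hr1, ← mul_assoc, hpi,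
    ← charFun_arcLaw hr hr1 hκ1] at hlim
  refine hlim.congr fun n => ?_
  simp only [locationProb_eq_of_phase j U φ.1 hl hm hL hR]
  -- The period starts at `-π/2` so that `ξ ↦ π - ξ` exchanges its halves.
  rw [sum_locationProb_mul_exp _ _ _ _ (-(Real.pi / 2))]
  rfl

end QuantumWalk

end

theorem theorem3 (j : QuantumWalk.WalkType) (U : Matrix.unitaryGroup (Fin 2) ℂ)
    (hU : U 0 0 * U 0 1 * U 1 0 * U 1 1 ≠ 0) (φ : QuantumWalk.QubitState)
    {Ω : ℕ → Type*} [∀ n, MeasurableSpace (Ω n)]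
    (P : ∀ n, Measure (Ω n)) [∀ n, IsProbabilityMeasure (P n)]
    (X : ∀ n, Ω n → ℤ)
    (hX : ∀ n, HasLaw (X n) (QuantumWalk.walkPMF j U φ n).toMeasure (P n)) :
    (∀ x, 0 ≤ QuantumWalk.limitDensity j U φ.1 x) ∧
    ∃ μ : ProbabilityMeasure ℝ,
      (μ : Measure ℝ) =
        volume.withDensity (fun x => ENNReal.ofReal (QuantumWalk.limitDensity j U φ.1 x)) ∧
      TendstoInDistribution (fun n ω => (X n ω : ℝ) / (n : ℝ)) atTop (fun x : ℝ => x) P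
        (μ : Measure ℝ) ∧
      Integrable (fun x : ℝ => x) (μ : Measure ℝ) ∧
      ∫ x, x ∂(μ : Measure ℝ) =
        -QuantumWalk.asymmetry j U φ.1 * (1 - √(1 - ‖U 0 0‖ ^ 2)) ∧
      Integrable (fun x : ℝ => x ^ 2) (μ : Measure ℝ) ∧
      ∫ x, x ^ 2 ∂(μ : Measure ℝ) = 1 - √(1 - ‖U 0 0‖ ^ 2) := by
  have ha : U 0 0 ≠ 0 := fun h => hU (by simp [h])
  have hb : U 0 1 ≠ 0 := fun h => hU (by simp [h])
  have hr : 0 < ‖U 0 0‖ := norm_pos_iff.2 ha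
  have hr1 : ‖U 0 0‖ < 1 := by
    nlinarith [(QuantumWalk.unitary_fin_two U).1, norm_pos_iff.2 hb]
  -- The bound does not involve `t`; the value 0 is arbitrary.
  have hκ := (QuantumWalk.tendsto_charFun_walk j U φ ha hb 0).1
  have hP := QuantumWalk.isProbabilityMeasure_arcLaw hr hr1 hκ
  rw [QuantumWalk.limitDensity_eq_arcDensity]
  have hm : ∀ n : ℕ, Measurable fun k : ℤ => (k : ℝ) / (n : ℝ) := fun n => by fun_prop
  obtain ⟨μ, hμ⟩ : ∃ μ : ProbabilityMeasure ℝ,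
      (μ : Measure ℝ) = QuantumWalk.arcLaw ‖U 0 0‖ (QuantumWalk.asymmetry j U φ.1) :=
    ⟨⟨_, hP⟩, rfl⟩
  refine ⟨QuantumWalk.arcDensity_nonneg hr1 hκ, μ, hμ,
    ⟨fun n => (hm n).comp_aemeasurable (hX n).aemeasurable, aemeasurable_id, ?_⟩, ?_⟩
  · refine ProbabilityMeasure.tendsto_iff_tendsto_charFun.2 fun t => ?_
    simp only [ProbabilityMeasure.coe_mk, Measure.map_id', hμ]
    refine ((QuantumWalk.tendsto_charFun_walk j U φ ha hb t).2).congr fun n => ?_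
    exact (QuantumWalk.charFun_map_div j U φ n (hX n) t).symm
  · rw [hμ]
    exact ⟨QuantumWalk.integrable_arcLaw hr hr1 hκ continuous_id,
      QuantumWalk.integral_id_arcLaw hr hr1 hκ,
      QuantumWalk.integrable_arcLaw hr hr1 hκ (continuous_id.pow 2),
      QuantumWalk.integral_sq_arcLaw hr hr1 hκ⟩
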